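/- Notation. For $r\in[0,\infty]$ let $\overline B_r=\{w\in\mathbb R^d: |w_i|\le r \text{ for all } i\}$ (so $\overline B_\infty=\mathbb R^d$), let $\overline B(w,r)$ be the closed Euclidean ball and $\|\cdot\|_2$ the Euclidean norm. For $A\subseteq\mathbb R^d$ and $w\in A$ let $\widehat N(w,A)=\{y:\limsup_{x\to w,\,x\in A\setminus\{w\}}\langle y,x-w\rangle/\|x-w\|_2\le 0\}$ be the Fréchet normal cone and let the Mordukhovich normal cone $N(w,A)$ be the set of all limits of sequences $v_n\in\widehat N(x_n,A)$ with $x_n\in A$, $x_n\to w$. Let $\overline\partial f$ be the Clarke subdifferential and, for $\epsilon\ge 0$, let $\overline\partial_\epsilon f(w)=\operatorname{co}\bigcup_{x\in\overline B(w,\epsilon)}\overline\partial f(x)$ be the Clarke $\epsilon$-subdifferential. Setting. Let $\alpha>0$, $\widehat\alpha=\sqrt d\,\frac{\alpha}{2}$, and let $\beta,\kappa\in(0,\infty]$ satisfy $\kappa>\beta+\widehat\alpha$, or $\beta=\kappa=\infty$. Let $\xi$ be a random vector in $\mathbb R^p$, and let $F(w,\xi)$ be real-valued and Borel measurable on $\overline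 B_\kappa\times\mathbb R^p$, continuous in $w\in\overline B_\kappa$ for each $\xi$ and integrable in $\xi$ for each $w\in\overline B_\kappa$. Assume that there is a measurable $L_0(\xi)$ with $Q:=\mathbb E[L_0(\xi)^2]<\infty$ such that, for almost every $\xi$, $|F(w,\xi)-F(w',\xi)|\le L_0(\xi)\|w-w'\|_2$ for all $w,w'\in\overline B_\kappa$; put $L_0:=\mathbb E[L_0(\xi)]$ and assume $d\ge1$ and $L_0>0$. Let $f(w)=\mathbb E[F(w,\xi)]$ and $f_\alpha(w)=\mathbb E[f(w+u)]$, where $u$ is uniformly distributed on $\overline B_{\alpha/2}$. Let $dF(w,u,\xi)\in\mathbb R^d$ have as $i$-th component the difference of the values of $F(\cdot,\xi)$ at $w+u$ with its $i$-th coordinate replaced by $w_i+\frac\alpha2$ and by $w_i-\frac\alpha2$, respectively. Let $\widetilde\nabla F$ be Borel measurable on $\overline B_{\beta+\alpha/2}\times\mathbb R^p$ and such that for every $w\in\overline B_\beta$, $\widetilde\nabla F(w+u,\xi)=\nabla F(w+u,\xi)$ (gradient in the first argument) for almost every $(u,\xi)$ with respect to the product of the laws of $u$ and $\xi$; it is needed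 only in setting (2). Let $S\subseteq\mathbb R^d$ be closed. Algorithm (SPA). Let $\rho>0$ and $\tau\ge0$ with $\rho+\tau>1$, let $\eta=\frac{\alpha}{3\rho\sqrt d L_0}$, let $K,M$ be positive integers and let $w^1\in S\cap\overline B_\beta$. For $k=1,2,\dots,K$ draw $u^{k,i}\sim u$ and $\xi^{k,i}\sim\xi$ for $i=1,\dots,M$, all independent of each other and of the past, and let $w^{k+1}$ be an element of the Euclidean projection of $w^k-\eta G^k$ onto $S\cap\overline B_\beta$, selected measurably and without knowledge of future samples or of $R$, where either (1) $G^k=\frac1{M\alpha}\sum_{i=1}^M dF(w^k,u^{k,i},\xi^{k,i})$ in every iteration, with $\upsilon:=d$, or (2) $G^k=\frac1M\sum_{i=1}^M\widetilde\nabla F(w^k+u^{k,i},\xi^{k,i})$ in every iteration, with $\upsilon:=1$. The output is $w^R$, where $R$ is uniformly distributed on $\{2,\dots,K+1\}$ and independent of the iterations. Claim. Let $w^*_\alpha$ be a minimizer of $f_\alpha$ over $S\cap\overline B_\beta$ and let $\Delta\ge f_\alpha(w^1)-f_\alpha(w_\alpha^*)$. Then $$\mathbb E\big[\operatorname{dist}\big(0,\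 \overline\partial_{\widehat\alpha}f(w^R)+N(w^R,S\cap\overline B_\beta)\big)^2\big]\ \le\ C_1\,\frac{2\alpha^{-1}\sqrt d\,L_0\,\Delta}{K}+C_2\,\frac{\upsilon Q}{M},$$ where $C_1=\frac{2(1+3\rho)}{\tau+\rho-1}+3\rho$ and $C_2=\frac{4(1+3\rho)}{\tau+\rho-1}\Big(\frac12+\frac23\frac{M\tau}{\rho^2}\Big)+3$. -/

import Mathlib

open MeasureTheory ProbabilityTheory Filter Topology
open scoped ENNReal Pointwise

noncomputable section

namespace SPA

/-- `ℝ^d` with its Euclidean norm. -/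
abbrev E (d : ℕ) : Type := EuclideanSpace ℝ (Fin d)

/-- The closed `l_∞`-ball of radius `r ∈ [0, ∞]` centred at `0`; for `r = ∞` it is all of `ℝ^d`. -/
def box (d : ℕ) (r : ℝ≥0∞) : Set (E d) := {w | ∀ i, ENNReal.ofReal |w i| ≤ r}

/-- The uniform distribution on the closed `l_∞`-ball of radius `α / 2`. -/
def unifBox (d : ℕ) (α : ℝ) : Measure (E d) :=
  ProbabilityTheory.cond volume (box d (ENNReal.ofReal (α / 2)))

/-! ### Variational analysis -/

/-- Euclidean projection (set-valued) onto `A`. -/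
def proj {d : ℕ} (A : Set (E d)) (x : E d) : Set (E d) :=
  {y | y ∈ A ∧ ∀ z ∈ A, ‖y - x‖ ≤ ‖z - x‖}

/-- Fréchet normal cone of `A` at `w` (empty when `w ∉ A`). -/
def frechetNormalCone {d : ℕ} (A : Set (E d)) (w : E d) : Set (E d) :=
  {y | w ∈ A ∧
    limsup (fun x : E d => ((inner ℝ y (x - w) / ‖x - w‖ : ℝ) : EReal)) (𝓝[A \ {w}] w) ≤ 0}

/-- Mordukhovich (limiting) normal cone of `A` at `w` (empty when `w ∉ A`). -/
def normalCone {d : ℕ} (A : Set (E d)) (w : E d) : Set (E d) :=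
  {y | w ∈ A ∧ ∃ x v : ℕ → E d, (∀ n, x n ∈ A) ∧ Tendsto x atTop (𝓝 w) ∧
    Tendsto v atTop (𝓝 y) ∧ ∀ n, v n ∈ frechetNormalCone A (x n)}

/-- Clarke's generalized directional derivative `f°(x; v)`. -/
def clarkeDeriv {d : ℕ} (f : E d → ℝ) (x v : E d) : EReal :=
  limsup (fun z : E d × ℝ => (((f (z.1 + z.2 • v) - f z.1) / z.2 : ℝ) : EReal))
    (𝓝 x ×ˢ 𝓝[>] (0 : ℝ))

/-- Clarke subdifferential of `f` at `x`. -/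
def clarke {d : ℕ} (f : E d → ℝ) (x : E d) : Set (E d) :=
  {g | ∀ v, ((inner ℝ g v : ℝ) : EReal) ≤ clarkeDeriv f x v}

/-- Clarke `ε`-subdifferential (Goldstein) of `f` at `w`. -/
def clarkeEps {d : ℕ} (ε : ℝ) (f : E d → ℝ) (w : E d) : Set (E d) :=
  convexHull ℝ (⋃ x ∈ Metric.closedBall w ε, clarke f x)

/-! ### The stochastic loss and its smoothing -/

/-- Standing assumptions on the stochastic loss `F (w, ξ)`, where `μ` is the law of `ξ` and
`L` is the random Lipschitz constant. Nothing is required of `F` for `w` outside `box d κ`. -/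
structure LossAssumptions {d p : ℕ} (μ : Measure (E p)) (κ : ℝ≥0∞) (F : E d → E p → ℝ)
    (L : E p → ℝ) : Prop where
  measurable_loss : Measurable fun z : box d κ × E p => F z.1 z.2
  integrable_loss : ∀ w ∈ box d κ, Integrable (F w) μ
  continuous_loss : ∀ ξ, ContinuousOn (fun w => F w ξ) (box d κ)
  measurable_lip : Measurable L
  lipschitz_loss : ∀ᵐ ξ ∂μ, ∀ w ∈ box d κ, ∀ w' ∈ box d κ, |F w ξ - F w' ξ| ≤ L ξ * ‖w - w'‖
  sq_integrable_lip : Integrable (fun ξ => L ξ ^ 2) μ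

/-- The loss `f w = 𝔼[F (w, ξ)]`. -/
def loss {d p : ℕ} (μ : Measure (E p)) (F : E d → E p → ℝ) (w : E d) : ℝ := ∫ ξ, F w ξ ∂μ

/-- The smoothing `f_α w = 𝔼[f (w + u)]`, with `u` uniform on the `l_∞`-ball of radius `α / 2`. -/
def smooth {d : ℕ} (α : ℝ) (f : E d → ℝ) (w : E d) : ℝ := ∫ u, f (w + u) ∂unifBox d α

/-- The finite difference `dF (w, u, ξ)`: its `i`-th component is the difference of the values of
`F (·, ξ)` at `w + u` with the `i`-th coordinate replaced by `w i + α / 2`, resp. `w i - α / 2`. -/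
def finDiff {d p : ℕ} (α : ℝ) (F : E d → E p → ℝ) (w u : E d) (ξ : E p) : E d :=
  WithLp.toLp 2 fun i =>
    F (WithLp.toLp 2 (Function.update (fun j => w j + u j) i (w i + α / 2))) ξ -
      F (WithLp.toLp 2 (Function.update (fun j => w j + u j) i (w i - α / 2))) ξ

/-- `gradF` is an admissible choice of the function written `∇̃F`: Borel measurable, and for every
`w` in the `β`-box equal to `∇F (w + u, ξ)` for almost every `(u, ξ)`. -/
structure IsGradVersion {d p : ℕ} (μ : Measure (E p)) (α : ℝ) (β : ℝ≥0∞) (F : E d → E p → ℝ)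
    (gradF : E d → E p → E d) : Prop where
  measurable_grad :
    Measurable fun z : box d (β + ENNReal.ofReal (α / 2)) × E p => gradF z.1 z.2
  ae_eq_grad : ∀ w ∈ box d β, ∀ᵐ z ∂(unifBox d α).prod μ,
    HasGradientAt (fun v => F v z.2) (gradF (w + z.1) z.2) (w + z.1)

/-! ### The algorithm -/

/-- The two settings of the algorithm: `IsEstimator μ α β F g υ` says that the one-sample estimator
`g (w, u, ξ)` is either the zeroth-order one, `α⁻¹ dF (w, u, ξ)`, with `υ = d`, or the first-order
one, `∇̃F (w + u, ξ)`, with `υ = 1`. -/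
inductive IsEstimator {d p : ℕ} (μ : Measure (E p)) (α : ℝ) (β : ℝ≥0∞) (F : E d → E p → ℝ) :
    (E d → E d → E p → E d) → ℝ → Prop
  | zerothOrder : IsEstimator μ α β F (fun w u ξ => α⁻¹ • finDiff α F w u ξ) (d : ℝ)
  | firstOrder (gradF : E d → E p → E d) (h : IsGradVersion μ α β F gradF) :
      IsEstimator μ α β F (fun w u ξ => gradF (w + u) ξ) 1

/-- A run of the stochastic projected algorithm on the feasible set `A` with step size `η`,
`K` as iteration parameter, mini-batches of size `M`, one-sample estimator `g`, starting at `w₁`.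
`w k` is the `k`-th iterate (`k = 1, …, K + 1`), `u k i` and `ξ k i` (`i < M`) are the samples drawn
in iteration `k`, and `R` is the random index of the output `w^R`, drawn independently of the
iterations. `ℱ k` is the information available before iteration `k`: the fresh samples are
independent of it, and the element of the (set-valued) projection is chosen, in any measurable
way, without knowledge of later samples or of `R`. -/
structure IsRun {Ω : Type*} {mΩ : MeasurableSpace Ω} (P : Measure Ω) {d p : ℕ}
    (μ : Measure (E p)) (α : ℝ) (A : Set (E d)) (η : ℝ) (K M : ℕ)
    (g : E d → E d → E p → E d) (w₁ : E d)
    (ℱ : Filtration ℕ mΩ) (u : ℕ → Fin M → Ω → E d) (ξ : ℕ → Fin M → Ω → E p)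
    (R : Ω → ℕ) (w : ℕ → Ω → E d) : Prop where
  measurable_R : Measurable R
  uniform_R : ∀ k ∈ Finset.Icc 2 (K + 1), P {ω | R ω = k} = (K : ℝ≥0∞)⁻¹
  indep_R : Indep (MeasurableSpace.comap R ⊤) (ℱ (K + 1)) P
  measurable_u : ∀ k ∈ Finset.Icc 1 K, ∀ i, Measurable[ℱ (k + 1)] (u k i)
  measurable_ξ : ∀ k ∈ Finset.Icc 1 K, ∀ i, Measurable[ℱ (k + 1)] (ξ k i)
  law_sample : ∀ k ∈ Finset.Icc 1 K, ∀ i,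
    P.map (fun ω => (u k i ω, ξ k i ω)) = (unifBox d α).prod μ
  indep_batch : ∀ k ∈ Finset.Icc 1 K, iIndepFun (fun i ω => (u k i ω, ξ k i ω)) P
  indep_past : ∀ k ∈ Finset.Icc 1 K,
    Indep (MeasurableSpace.comap (fun ω i => (u k i ω, ξ k i ω)) MeasurableSpace.pi) (ℱ k) P
  measurable_w : ∀ k ∈ Finset.Icc 1 (K + 1), Measurable[ℱ k] (w k)
  start : ∀ ω, w 1 ω = w₁
  step : ∀ k ∈ Finset.Icc 1 K, ∀ᵐ ω ∂P,
    w (k + 1) ω ∈ proj A (w k ω - (η / M) • ∑ i, g (w k ω) (u k i ω) (ξ k i ω))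

/-- The constant `C₁`. -/
def C₁ (ρ τ : ℝ) : ℝ := 2 * (1 + 3 * ρ) / (τ + ρ - 1) + 3 * ρ

/-- The constant `C₂`. -/
def C₂ (ρ τ : ℝ) (M : ℕ) : ℝ :=
  4 * (1 + 3 * ρ) / (τ + ρ - 1) * (1 / 2 + 2 / 3 * (M * τ / ρ ^ 2)) + 3

end SPA

end

namespace SPA

/-! ### Boxes and the uniform distribution on them -/

/-! The smoothed loss `f_α` links the algorithm to the nonsmooth problem. Its gradient at `w` is the
average of `∇f` over the box of half-width `α / 2` around `w`. That box lies in the Euclidean ball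
of radius `√d * (α / 2)`, so by Rademacher's theorem the average belongs to the closure of the
Clarke subdifferential with that radius (`smoothGrad_mem_closure_clarkeEps`). Averaging along
coordinate `i` first turns the `i`-th partial derivative into `α⁻¹` times a mean difference of `f`
across opposite faces (`smoothGrad_apply`). Hence the gradient is Lipschitz with constant `Λ = 2 α⁻¹
√d L₀`, and both estimators are unbiased for it, with second moment at most `υ Q`.

If `y` is a projection of `x - η g` onto a set, convex or not, then `η⁻¹ (x - η g - y)` is a Fréchet
normal at `y`. So the residual `∇f_α(y) - g - η⁻¹ (y - x)` lies in the closure of subdifferential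
plus normal cone, and its norm bounds the distance in the claim. With `η = 2 / (3 ρ Λ)`,
`sq_norm_stationarity_le` bounds the squared residual by the decrease of `f_α`, the squared error of
`g` and, weighted by `τ`, the squared norm of `g`.

Along a run (`IsRun.lintegral_stationarity_le`) the decreases telescope to at most `Δ`, each error
costs at most `υ Q / M` and each squared norm at most `υ Q`; the uniform index divides the sum by
`K`.

Since `F` is controlled on the `κ`-box only, it is first composed with a retraction onto that box.
Every point whose subdifferential matters has a neighbourhood inside the box, where nothing changes.
-/

lemma mem_box_ofReal {d : ℕ} {r : ℝ} (hr : 0 ≤ r) {w : E d} :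
    w ∈ box d (ENNReal.ofReal r) ↔ ∀ i, |w i| ≤ r := by
  simp only [box, Set.mem_ofPred_eq, ENNReal.ofReal_le_ofReal_iff hr]

lemma box_top (d : ℕ) : box d ⊤ = Set.univ := by
  ext w; simp [box]

lemma isClosed_box (d : ℕ) (r : ℝ≥0∞) : IsClosed (box d r) := by
  have : box d r = ⋂ i, {w : E d | ENNReal.ofReal |w i| ≤ r} := by ext w; simp [box]
  rw [this]
  refine isClosed_iInter fun i => isClosed_le ?_ continuous_const
  exact ENNReal.continuous_ofReal.comp (by fun_prop)

lemma box_mono (d : ℕ) {r s : ℝ≥0∞} (h : r ≤ s) : box d r ⊆ box d s :=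
  fun _ hw i => (hw i).trans h

lemma add_mem_box {d : ℕ} {r s : ℝ≥0∞} {w u : E d} (hw : w ∈ box d r) (hu : u ∈ box d s) :
    w + u ∈ box d (r + s) := fun i => by
  calc ENNReal.ofReal |w i + u i| ≤ ENNReal.ofReal (|w i| + |u i|) :=
        ENNReal.ofReal_le_ofReal (abs_add_le _ _)
    _ = ENNReal.ofReal |w i| + ENNReal.ofReal |u i| :=
        ENNReal.ofReal_add (abs_nonneg _) (abs_nonneg _)
    _ ≤ r + s := add_le_add (hw i) (hu i)

lemma mem_box_of_norm_le {d : ℕ} {u : E d} {r : ℝ} (h : ‖u‖ ≤ r) :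
    u ∈ box d (ENNReal.ofReal r) := fun i =>
  ENNReal.ofReal_le_ofReal (((Real.norm_eq_abs _).symm.le.trans (PiLp.norm_apply_le u i)).trans h)

lemma box_mem_nhds {d : ℕ} {r s : ℝ≥0∞} (h : r < s ∨ s = ⊤) {w : E d} (hw : w ∈ box d r) :
    box d s ∈ 𝓝 w := by
  rcases h with h | rfl
  · have h1 : ∀ i, ∀ᶠ x : E d in 𝓝 w, ENNReal.ofReal |x i| < s := fun i => by
      have hc : Continuous fun x : E d => ENNReal.ofReal |x i| :=
        ENNReal.continuous_ofReal.comp (by fun_prop)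
      exact hc.continuousAt.eventually_lt continuousAt_const ((hw i).trans_lt h)
    filter_upwards [eventually_all.2 h1] with x hx i using (hx i).le
  · simp [box_top]

lemma norm_le_of_forall_abs_le {d : ℕ} {u : E d} {r : ℝ} (hr : 0 ≤ r) (h : ∀ i, |u i| ≤ r) :
    ‖u‖ ≤ √(d : ℝ) * r := by
  have h2 : ‖u‖ ^ 2 ≤ (√(d : ℝ) * r) ^ 2 := by
    rw [EuclideanSpace.norm_sq_eq, mul_pow, Real.sq_sqrt (Nat.cast_nonneg d)]
    calc ∑ i, ‖u i‖ ^ 2 ≤ ∑ _i : Fin d, r ^ 2 :=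
          Finset.sum_le_sum fun i _ => pow_le_pow_left₀ (norm_nonneg _) (h i) 2
      _ = d * r ^ 2 := by simp
  exact (abs_le_of_sq_le_sq' h2 (by positivity)).2

/-- A nonexpansive retraction of the space onto a box. -/
lemma exists_retraction (d : ℕ) (κ : ℝ≥0∞) : ∃ c : E d → E d, LipschitzWith 1 c ∧
    (∀ w, c w ∈ box d κ) ∧ ∀ w ∈ box d κ, c w = w := by
  by_cases hκ : κ = ⊤
  · subst hκ
    exact ⟨id, LipschitzWith.id, by simp [box_top], by simp⟩
  obtain ⟨r, hr, rfl⟩ : ∃ r : ℝ, 0 ≤ r ∧ κ = ENNReal.ofReal r :=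
    ⟨κ.toReal, ENNReal.toReal_nonneg, (ENNReal.ofReal_toReal hκ).symm⟩
  have hrr : -r ≤ r := by linarith
  refine ⟨fun w => WithLp.toLp 2 fun i => (Set.projIcc (-r) r hrr (w i) : ℝ), ?_, ?_, ?_⟩
  · refine LipschitzWith.of_dist_le_mul fun x y => ?_
    rw [NNReal.coe_one, one_mul, EuclideanSpace.dist_eq, EuclideanSpace.dist_eq]
    refine Real.sqrt_le_sqrt (Finset.sum_le_sum fun i _ => pow_le_pow_left₀ dist_nonneg ?_ 2)
    have := (LipschitzWith.projIcc hrr).dist_le_mul (x i) (y i)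
    simpa [Subtype.dist_eq] using this
  · intro w
    rw [mem_box_ofReal hr]
    exact fun i => abs_le.2 (Set.projIcc (-r) r hrr (w i)).2
  · intro w hw
    rw [mem_box_ofReal hr] at hw
    ext i
    simp [Set.projIcc_of_mem hrr (abs_le.1 (hw i))]

/-- The uniform distribution on `[-r, r]`. -/
noncomputable def unifIcc (r : ℝ) : Measure ℝ := ProbabilityTheory.cond volume (Set.Icc (-r) r)

lemma isProbabilityMeasure_unifIcc {r : ℝ} (hr : 0 < r) : IsProbabilityMeasure (unifIcc r) := by
  refine cond_isProbabilityMeasure_of_finite ?_ ?_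
  · rw [Real.volume_Icc]; simp; linarith
  · rw [Real.volume_Icc]; simp

lemma box_eq_preimage {d : ℕ} {r : ℝ} (hr : 0 ≤ r) : box d (ENNReal.ofReal r) =
    (@WithLp.ofLp 2 (Fin d → ℝ)) ⁻¹' (Set.univ.pi fun _ => Set.Icc (-r) r) := by
  ext w
  rw [mem_box_ofReal hr]
  simp only [Set.mem_preimage, Set.mem_univ_pi, Set.mem_Icc, abs_le]

/-- The product structure makes the coordinates of `u` independent, so that one of them can be
resampled. -/
lemma unifBox_eq_map {d : ℕ} {α : ℝ} (hα : 0 < α) :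
    unifBox d α = (Measure.pi fun _ : Fin d => unifIcc (α / 2)).map (WithLp.toLp 2) := by
  have hr : 0 < α / 2 := by positivity
  have := isProbabilityMeasure_unifIcc hr
  have hpi : (Measure.pi fun _ : Fin d => unifIcc (α / 2)) =
      ProbabilityTheory.cond volume (Set.univ.pi fun _ => Set.Icc (-(α / 2)) (α / 2)) := by
    refine Measure.pi_eq fun s hs => ?_
    rw [cond_apply (MeasurableSet.univ_pi fun _ => measurableSet_Icc), ← Set.pi_inter_distrib,
      volume_pi_pi, volume_pi_pi, ENNReal.prod_inv_distrib, ← Finset.prod_mul_distrib]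
    · refine Finset.prod_congr rfl fun i _ => ?_
      rw [unifIcc, cond_apply measurableSet_Icc]
    · intro i _ j _ _
      right
      rw [Real.volume_Icc]; simp
  rw [hpi, unifBox, box_eq_preimage hr.le]
  ext s hs
  have hmp := PiLp.volume_preserving_ofLp (Fin d)
  have hm : MeasurableSet (Set.univ.pi fun _ : Fin d => Set.Icc (-(α / 2)) (α / 2)) :=
    MeasurableSet.univ_pi fun _ => measurableSet_Icc
  rw [Measure.map_apply (by fun_prop) hs, cond_apply hm, cond_apply (hmp.measurable hm),
    hmp.measure_preimage hm.nullMeasurableSet,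
    ← hmp.measure_preimage
      (hm.inter ((show Measurable (WithLp.toLp 2) by fun_prop) hs)).nullMeasurableSet]
  rfl

lemma isProbabilityMeasure_unifBox {d : ℕ} {α : ℝ} (hα : 0 < α) :
    IsProbabilityMeasure (unifBox d α) := by
  have := isProbabilityMeasure_unifIcc (half_pos hα)
  rw [unifBox_eq_map hα]
  exact Measure.isProbabilityMeasure_map (by fun_prop)

lemma ae_mem_box (d : ℕ) (α : ℝ) : ∀ᵐ u ∂unifBox d α, u ∈ box d (ENNReal.ofReal (α / 2)) :=
  ae_cond_mem (isClosed_box _ _).measurableSet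

lemma unifBox_absolutelyContinuous (d : ℕ) (α : ℝ) : unifBox d α ≪ volume :=
  cond_absolutelyContinuous

lemma integrable_unifBox_of_continuous {d : ℕ} {α : ℝ} (hα : 0 < α) {h : E d → ℝ}
    (hh : Continuous h) : Integrable h (unifBox d α) := by
  have hb : IsCompact (box d (ENNReal.ofReal (α / 2))) := by
    refine Metric.isCompact_of_isClosed_isBounded (isClosed_box _ _) ?_
    refine (Metric.isBounded_closedBall (x := (0 : E d)) (r := √(d : ℝ) * (α / 2))).subset ?_
    intro w hw
    rw [mem_box_ofReal (by positivity)] at hw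
    simpa using norm_le_of_forall_abs_le (by positivity) hw
  have := isProbabilityMeasure_unifBox (d := d) hα
  obtain ⟨C, hC⟩ := hb.exists_bound_of_continuousOn hh.continuousOn
  exact Integrable.of_bound hh.aestronglyMeasurable C ((ae_mem_box d α).mono hC)

/-- `u` with its `i`-th coordinate replaced by `s`. -/
noncomputable def replace {d : ℕ} (u : E d) (i : Fin d) (s : ℝ) : E d :=
  WithLp.toLp 2 (Function.update u.ofLp i s)

lemma replace_apply {d : ℕ} (u : E d) (i : Fin d) (s : ℝ) (j : Fin d) :
    replace u i s j = if j = i then s else u j := by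
  simp [replace, Function.update_apply]

lemma dist_replace {d : ℕ} (u : E d) (i : Fin d) (s t : ℝ) :
    dist (replace u i s) (replace u i t) = dist s t := by
  have : replace u i s - replace u i t = EuclideanSpace.single i (s - t) := by
    ext j
    rw [PiLp.sub_apply, replace_apply, replace_apply]
    by_cases h : j = i
    · subst h; simp
    · simp [h]
  rw [dist_eq_norm, this, PiLp.norm_single, Real.dist_eq, Real.norm_eq_abs]

lemma continuous_replace {d : ℕ} (i : Fin d) :
    Continuous fun z : E d × ℝ => replace z.1 i z.2 := by
  simp only [replace]; fun_prop

/-- Resampling a coordinate does not change the uniform distribution. -/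
lemma measurePreserving_replace {d : ℕ} {α : ℝ} (hα : 0 < α) (i : Fin d) :
    MeasurePreserving (fun z : E d × ℝ => replace z.1 i z.2)
      ((unifBox d α).prod (unifIcc (α / 2))) (unifBox d α) := by
  have := isProbabilityMeasure_unifIcc (half_pos hα)
  have := isProbabilityMeasure_unifBox (d := d) hα
  refine ⟨(continuous_replace i).measurable, ?_⟩
  have hp : ((Measure.pi fun _ : Fin d => unifIcc (α / 2)).prod (unifIcc (α / 2))).map
      (fun z : (Fin d → ℝ) × ℝ => Function.update z.1 i z.2) =
      Measure.pi fun _ : Fin d => unifIcc (α / 2) := by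
    refine (Measure.pi_eq fun s hs => ?_).symm
    have hc : Continuous fun z : (Fin d → ℝ) × ℝ => Function.update z.1 i z.2 := by fun_prop
    rw [Measure.map_apply hc.measurable (MeasurableSet.univ_pi hs)]
    -- The overwritten coordinate is unconstrained and contributes mass one; the fresh variable
    -- supplies the missing factor.
    have : (fun z : (Fin d → ℝ) × ℝ => Function.update z.1 i z.2) ⁻¹' Set.univ.pi s =
        (Set.univ.pi (Function.update s i Set.univ)) ×ˢ s i := by
      ext ⟨x, t⟩
      simp only [Set.mem_preimage, Set.mem_pi, Set.mem_univ, true_imp_iff, Set.mem_prod]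
      constructor
      · intro h
        refine ⟨fun j => ?_, by simpa using h i⟩
        by_cases hj : j = i
        · subst hj; simp
        · simpa [hj] using h j
      · rintro ⟨h1, h2⟩ j
        by_cases hj : j = i
        · subst hj; simpa using h2
        · simpa [hj] using h1 j
    rw [this, Measure.prod_prod, Measure.pi_pi, ← Finset.mul_prod_erase _ _ (Finset.mem_univ i),
      ← Finset.mul_prod_erase _ (fun j => unifIcc (α / 2) (s j)) (Finset.mem_univ i)]
    simp only [Function.update_self, measure_univ, one_mul]
    rw [mul_comm]
    congr 1
    exact Finset.prod_congr rfl fun j hj => by simp [Finset.ne_of_mem_erase hj]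
  have h2 : (unifBox d α).prod (unifIcc (α / 2)) =
      ((Measure.pi fun _ : Fin d => unifIcc (α / 2)).prod (unifIcc (α / 2))).map
        (Prod.map (WithLp.toLp 2) id) := by
    rw [unifBox_eq_map hα, ← Measure.map_prod_map _ _ (by fun_prop) measurable_id, Measure.map_id]
  rw [h2, Measure.map_map (continuous_replace i).measurable (by fun_prop)]
  conv_rhs => rw [unifBox_eq_map hα, ← hp, Measure.map_map (by fun_prop) (by
    exact (show Continuous fun z : (Fin d → ℝ) × ℝ => Function.update z.1 i z.2 by
      fun_prop).measurable)]
  rfl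

/-! ### Normal cones and Clarke subdifferentials -/

/-- Squaring `‖p - x‖ ≤ ‖z - x‖` gives `⟨x - p, z - p⟩ ≤ ‖z - p‖² / 2`, so the quotient is at most
`t / 2 * ‖z - p‖`, which vanishes as `z → p`. No convexity is involved. At an isolated point the
filter is trivial. -/
lemma smul_sub_mem_frechetNormalCone {d : ℕ} {A : Set (E d)} {x p : E d} (hp : p ∈ proj A x)
    {t : ℝ} (ht : 0 ≤ t) : t • (x - p) ∈ frechetNormalCone A p := by
  refine ⟨hp.1, ?_⟩
  rcases (𝓝[A \ {p}] p).eq_or_neBot with h | h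
  · rw [h]; simp
  have hlim : Tendsto (fun z : E d => ((t / 2 * ‖z - p‖ : ℝ) : EReal)) (𝓝[A \ {p}] p) (𝓝 0) := by
    rw [← EReal.coe_zero]
    refine (continuous_coe_real_ereal.tendsto 0).comp ?_
    have : Continuous fun z : E d => t / 2 * ‖z - p‖ := by fun_prop
    have h2 := (this.tendsto p).mono_left (nhdsWithin_le_nhds (s := A \ {p}))
    simpa using h2
  rw [← hlim.limsup_eq]
  refine limsup_le_limsup ?_
  filter_upwards [self_mem_nhdsWithin] with z hz
  have hz0 : 0 < ‖z - p‖ := norm_pos_iff.2 (sub_ne_zero.2 hz.2)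
  rw [EReal.coe_le_coe_iff, div_le_iff₀ hz0, real_inner_smul_left]
  have h1 := hp.2 z hz.1
  have h2 : ‖p - x‖ ^ 2 ≤ ‖z - x‖ ^ 2 := pow_le_pow_left₀ (norm_nonneg _) h1 2
  have h3 : z - x = (z - p) - (x - p) := by abel
  rw [h3, norm_sub_sq_real (z - p), norm_sub_rev p x, real_inner_comm] at h2
  nlinarith

lemma frechetNormalCone_subset_normalCone {d : ℕ} (A : Set (E d)) (w : E d) :
    frechetNormalCone A w ⊆ normalCone A w := fun y hy =>
  ⟨hy.1, fun _ => w, fun _ => y, fun _ => hy.1, tendsto_const_nhds, tendsto_const_nhds,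
    fun _ => hy⟩

/-- Freezing the base point at `x` can only lower the limsup, and along this smaller filter the
quotient converges to `⟨g, v⟩`. -/
lemma gradient_mem_clarke {d : ℕ} {f : E d → ℝ} {x g : E d} (h : HasGradientAt f g x) :
    g ∈ clarke f x := by
  intro v
  have hd : HasDerivAt (fun t : ℝ => f (x + t • v)) (inner ℝ g v) 0 := by
    have h1 : HasDerivAt (fun t : ℝ => x + t • v) v 0 := by
      simpa using ((hasDerivAt_id (0 : ℝ)).smul_const v).const_add x
    have h2 : HasFDerivAt f (InnerProductSpace.toDual ℝ (E d) g) (x + (0 : ℝ) • v) := by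
      simpa using h.hasFDerivAt
    exact h2.comp_hasDerivAt 0 h1
  have ht : Tendsto (fun t : ℝ => (((f (x + t • v) - f x) / t : ℝ) : EReal)) (𝓝[>] 0)
      (𝓝 ((inner ℝ g v : ℝ) : EReal)) := by
    refine (continuous_coe_real_ereal.tendsto _).comp ?_
    refine (hd.tendsto_slope_zero_right).congr fun t => ?_
    simp [div_eq_inv_mul]
  rw [← ht.limsup_eq]
  have hm : map (fun t : ℝ => (x, t)) (𝓝[>] 0) ≤ 𝓝 x ×ˢ 𝓝[>] (0 : ℝ) :=
    tendsto_const_nhds.prodMk tendsto_id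
  exact limsup_le_limsup_of_le
    (u := fun z : E d × ℝ => (((f (z.1 + z.2 • v) - f z.1) / z.2 : ℝ) : EReal)) hm

lemma clarke_congr {d : ℕ} {f h : E d → ℝ} {x : E d} (hfh : f =ᶠ[𝓝 x] h) :
    clarke f x = clarke h x := by
  have : ∀ v, clarkeDeriv f x v = clarkeDeriv h x v := fun v => by
    refine limsup_congr ?_
    have h1 : Tendsto (fun z : E d × ℝ => z.1) (𝓝 x ×ˢ 𝓝[>] (0 : ℝ)) (𝓝 x) := tendsto_fst
    have h2 : Tendsto (fun z : E d × ℝ => z.1 + z.2 • v) (𝓝 x ×ˢ 𝓝[>] (0 : ℝ)) (𝓝 x) := by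
      have h3 : Tendsto (fun z : E d × ℝ => z.2) (𝓝 x ×ˢ 𝓝[>] (0 : ℝ)) (𝓝 0) :=
        tendsto_snd.mono_right nhdsWithin_le_nhds
      simpa using h1.add (h3.smul_const v)
    filter_upwards [h1.eventually hfh, h2.eventually hfh] with z hz1 hz2
    rw [hz1, hz2]
  ext g
  simp only [clarke, this]

lemma clarkeEps_congr {d : ℕ} {f h : E d → ℝ} {ε : ℝ} {w : E d}
    (hfh : ∀ x ∈ Metric.closedBall w ε, f =ᶠ[𝓝 x] h) : clarkeEps ε f w = clarkeEps ε h w := by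
  rw [clarkeEps, clarkeEps]
  congr 1
  exact Set.iUnion₂_congr fun x hx => clarke_congr (hfh x hx)

/-- Distances do not see closures, so it suffices to have the smoothed gradient in the closure of
the subdifferential. -/
lemma infEDist_add_le {d : ℕ} {A B : Set (E d)} {a b : E d} (ha : a ∈ closure A) (hb : b ∈ B) :
    Metric.infEDist (0 : E d) (A + B) ≤ ‖a + b‖ₑ := by
  have hab : a + b ∈ closure (A + B) := by
    have : Set.MapsTo (fun x => x + b) A (A + B) := fun x hx => Set.add_mem_add hx hb
    exact this.closure (by fun_prop) ha
  rw [← Metric.infEDist_closure]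
  refine (Metric.infEDist_le_edist_of_mem hab).trans_eq ?_
  rw [edist_comm, edist_zero_right]

/-! ### Smoothing by averaging over a box -/

/-- Differentiation under the integral sign for gradients of globally Lipschitz integrands. -/
lemma hasGradientAt_integral {d : ℕ} {X : Type*} [MeasurableSpace X] {ν : Measure X}
    {H : E d → X → ℝ} {H' : X → E d} {bound : X → ℝ} {x₀ : E d}
    (hint : ∀ x, Integrable (H x) ν) (hm : AEStronglyMeasurable H' ν)
    (hlip : ∀ᵐ a ∂ν, ∀ x y, |H x a - H y a| ≤ bound a * ‖x - y‖) (hb : Integrable bound ν)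
    (hd : ∀ᵐ a ∂ν, HasGradientAt (fun x => H x a) (H' a) x₀) :
    Integrable H' ν ∧ HasGradientAt (fun x => ∫ a, H x a ∂ν) (∫ a, H' a ∂ν) x₀ := by
  have hm' : AEStronglyMeasurable (fun a => InnerProductSpace.toDual ℝ (E d) (H' a)) ν :=
    (InnerProductSpace.toDual ℝ (E d)).continuous.comp_aestronglyMeasurable hm
  obtain ⟨h1, h2⟩ := hasFDerivAt_integral_of_dominated_loc_of_lip' (𝕜 := ℝ) (s := Set.univ)
    (F := H) (x₀ := x₀) univ_mem (fun x _ => (hint x).aestronglyMeasurable) (hint x₀) hm'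
    (hlip.mono fun a ha x _ => ha x x₀) hb (hd.mono fun a ha => ha.hasFDerivAt)
  have hi : Integrable H' ν := by
    rw [← integrable_norm_iff hm]
    simpa using h1.norm
  refine ⟨hi, ?_⟩
  rw [hasGradientAt_iff_hasFDerivAt]
  have heq : InnerProductSpace.toDual ℝ (E d) (∫ a, H' a ∂ν) =
      ∫ a, InnerProductSpace.toDual ℝ (E d) (H' a) ∂ν := by
    refine ContinuousLinearMap.ext fun v => ?_
    rw [ContinuousLinearMap.integral_apply h1, InnerProductSpace.toDual_apply_apply,
      real_inner_comm, ← integral_inner hi]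
    simp only [InnerProductSpace.toDual_apply_apply, real_inner_comm]
  rw [heq]
  exact h2

/-- First-order Taylor estimate for a function with Lipschitz gradient. -/
lemma abs_sub_sub_inner_le {d : ℕ} {f : E d → ℝ} {g : E d → E d} {Λ : ℝ}
    (hf : ∀ z, HasGradientAt f (g z) z) (hg : ∀ z z', ‖g z - g z'‖ ≤ Λ * ‖z - z'‖) (x y : E d) :
    |f y - f x - inner ℝ (g x) (y - x)| ≤ Λ / 2 * ‖y - x‖ ^ 2 := by
  set v := y - x with hv
  have hd : ∀ t : ℝ, HasDerivAt (fun t : ℝ => f (x + t • v) - f x - t * inner ℝ (g x) v)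
      (inner ℝ (g (x + t • v) - g x) v) t := fun t => by
    have h1 : HasDerivAt (fun t : ℝ => x + t • v) v t := by
      simpa using ((hasDerivAt_id t).smul_const v).const_add x
    have h2 := (hf (x + t • v)).hasFDerivAt.comp_hasDerivAt t h1
    have h3 := (h2.sub_const (f x)).sub ((hasDerivAt_id t).mul_const (inner ℝ (g x) v))
    refine h3.congr_deriv ?_
    rw [inner_sub_left, InnerProductSpace.toDual_apply_apply, one_mul]
  have hB : ∀ t : ℝ, HasDerivAt (fun t : ℝ => Λ / 2 * ‖v‖ ^ 2 * t ^ 2) (Λ * ‖v‖ ^ 2 * t) t :=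
    fun t => ((hasDerivAt_pow 2 t).const_mul (Λ / 2 * ‖v‖ ^ 2)).congr_deriv (by
      push_cast; ring)
  -- Along the segment the remainder has derivative at most `Λ ‖v‖² t` in absolute value; comparison
  -- with its primitive yields the factor `1 / 2`.
  have key := image_norm_le_of_norm_deriv_right_le_deriv_boundary' (a := 0) (b := 1)
    (fun t _ => (hd t).continuousAt.continuousWithinAt) (fun t _ => (hd t).hasDerivWithinAt)
    (by simp) (fun t _ => (hB t).continuousAt.continuousWithinAt)
    (fun t _ => (hB t).hasDerivWithinAt) (fun t ht => by
      refine (norm_inner_le_norm _ _).trans ?_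
      refine (mul_le_mul_of_nonneg_right (hg _ _) (norm_nonneg v)).trans_eq ?_
      rw [add_sub_cancel_left, norm_smul, Real.norm_of_nonneg ht.1]
      ring) (Set.right_mem_Icc.2 zero_le_one)
  simpa [hv] using key

lemma integrable_unifIcc_of_continuous {r : ℝ} (hr : 0 < r) {h : ℝ → ℝ} (hh : Continuous h) :
    Integrable h (unifIcc r) := by
  have := isProbabilityMeasure_unifIcc hr
  obtain ⟨C, hC⟩ := (isCompact_Icc (a := -r) (b := r)).exists_bound_of_continuousOn hh.continuousOn
  exact Integrable.of_bound hh.aestronglyMeasurable C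
    ((ae_cond_mem measurableSet_Icc).mono hC)

lemma integral_unifIcc {α : ℝ} (hα : 0 < α) (h : ℝ → ℝ) :
    ∫ s, h s ∂unifIcc (α / 2) = α⁻¹ * ∫ s in -(α / 2)..α / 2, h s := by
  rw [unifIcc, ProbabilityTheory.cond, integral_smul_measure, integral_Icc_eq_integral_Ioc,
    ← intervalIntegral.integral_of_le (by linarith), Real.volume_Icc, smul_eq_mul]
  congr 1
  rw [ENNReal.toReal_inv, ENNReal.toReal_ofReal (by linarith)]
  congr 1
  ring

/-- The derivative of a sliding average. -/
lemma hasDerivAt_slidingAverage {α : ℝ} (hα : 0 < α) {h : ℝ → ℝ} (hh : Continuous h) :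
    HasDerivAt (fun t => ∫ s, h (s + t) ∂unifIcc (α / 2))
      (α⁻¹ * (h (α / 2) - h (-(α / 2)))) 0 := by
  have hint : ∀ a b, IntervalIntegrable h volume a b := fun a b => hh.intervalIntegrable a b
  have hp : ∀ c : ℝ, HasDerivAt (fun t => ∫ s in (0 : ℝ)..c + t, h s) (h c) 0 := fun c => by
    have h1 : HasDerivAt (fun x => ∫ s in (0 : ℝ)..x, h s) (h (c + 0)) (c + 0) :=
      intervalIntegral.integral_hasDerivAt_right (hint _ _)
        hh.stronglyMeasurable.stronglyMeasurableAtFilter hh.continuousAt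
    simpa using h1.comp_const_add c 0
  have := ((hp (α / 2)).sub (hp (-(α / 2)))).const_mul α⁻¹
  refine this.congr_of_eventuallyEq (Eventually.of_forall fun t => ?_)
  simp only [integral_unifIcc hα, Pi.sub_apply]
  rw [intervalIntegral.integral_comp_add_right, intervalIntegral.integral_interval_sub_left
    (hint _ _) (hint _ _)]

section Smoothing

variable {d : ℕ} {α : ℝ} {f : E d → ℝ} {C : NNReal}

/-- The `i`-th component of the average over the box of the finite difference of `f`. -/
noncomputable def meanFaceDiff (α : ℝ) (f : E d → ℝ) (w : E d) (i : Fin d) : ℝ :=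
  ∫ u, f (replace (w + u) i (w i + α / 2)) - f (replace (w + u) i (w i - α / 2)) ∂unifBox d α

/-- The gradient of the smoothing of `f`. -/
noncomputable def smoothGrad (α : ℝ) (f : E d → ℝ) (w : E d) : E d :=
  ∫ u, gradient f (w + u) ∂unifBox d α

lemma ae_hasGradientAt_add (hf : LipschitzWith C f) (w : E d) :
    ∀ᵐ u ∂unifBox d α, HasGradientAt f (gradient f (w + u)) (w + u) := by
  have h1 : ∀ᵐ x : E d, DifferentiableAt ℝ f x := hf.ae_differentiableAt
  have h2 := (measurePreserving_add_left (volume : Measure (E d)) w).quasiMeasurePreserving.ae h1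
  filter_upwards [unifBox_absolutelyContinuous d α h2] with u hu using hu.hasGradientAt

lemma measurable_gradient (f : E d → ℝ) : Measurable (gradient f) :=
  (InnerProductSpace.toDual ℝ (E d)).symm.continuous.measurable.comp (measurable_fderiv ℝ f)

lemma integrable_gradient_and_hasGradientAt_smooth (hα : 0 < α) (hf : LipschitzWith C f) (w : E d) :
    Integrable (fun u => gradient f (w + u)) (unifBox d α) ∧
      HasGradientAt (smooth α f) (smoothGrad α f w) w := by
  have := isProbabilityMeasure_unifBox (d := d) hα
  refine hasGradientAt_integral (H := fun x u => f (x + u)) (bound := fun _ => (C : ℝ))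
    (fun x => integrable_unifBox_of_continuous hα (hf.continuous.comp (by fun_prop)))
    ((measurable_gradient f).comp (by fun_prop)).aestronglyMeasurable
    (Eventually.of_forall fun u x y => ?_) (integrable_const _) ?_
  · have := hf.dist_le_mul (x + u) (y + u)
    rwa [dist_add_right, Real.dist_eq, dist_eq_norm] at this
  · filter_upwards [ae_hasGradientAt_add hf w] with u hu
    rw [hasGradientAt_iff_hasFDerivAt] at hu ⊢
    exact (hu.comp w ((hasFDerivAt_id w).add_const u)).congr_fderiv
      (ContinuousLinearMap.comp_id _)

lemma hasGradientAt_smooth (hα : 0 < α) (hf : LipschitzWith C f) (w : E d) :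
    HasGradientAt (smooth α f) (smoothGrad α f w) w :=
  (integrable_gradient_and_hasGradientAt_smooth hα hf w).2

/-- A closed convex set contains the mean of any probability law concentrated on it; here almost
every `∇f (w + u)` is a Clarke subgradient at a point within `√d * (α / 2)` of `w`. -/
lemma smoothGrad_mem_closure_clarkeEps (hα : 0 < α) (hf : LipschitzWith C f) (w : E d) :
    smoothGrad α f w ∈ closure (clarkeEps (√(d : ℝ) * (α / 2)) f w) := by
  have := isProbabilityMeasure_unifBox (d := d) hα
  refine (convex_convexHull ℝ _).closure.integral_mem isClosed_closure ?_
    (integrable_gradient_and_hasGradientAt_smooth hα hf w).1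
  filter_upwards [ae_hasGradientAt_add hf w, ae_mem_box d α] with u hu hub
  refine subset_closure (subset_convexHull ℝ _ (Set.mem_biUnion ?_ (gradient_mem_clarke hu)))
  rw [mem_box_ofReal (by positivity)] at hub
  simpa using norm_le_of_forall_abs_le (by positivity) hub

/-- Resampling coordinate `i` confines the shift by `t` to a one-dimensional inner integral, a
sliding average in `t`. -/
lemma smooth_add_single (hα : 0 < α) (hf : LipschitzWith C f) (w : E d) (i : Fin d) (t : ℝ) :
    Integrable (fun u => ∫ s, f (replace (w + u) i (w i + (s + t))) ∂unifIcc (α / 2))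
      (unifBox d α) ∧
    smooth α f (w + EuclideanSpace.single i t) =
      ∫ u, ∫ s, f (replace (w + u) i (w i + (s + t))) ∂unifIcc (α / 2) ∂unifBox d α := by
  have := isProbabilityMeasure_unifBox (d := d) hα
  have := isProbabilityMeasure_unifIcc (half_pos hα)
  have hc : Continuous fun u : E d => f (w + EuclideanSpace.single i t + u) :=
    hf.continuous.comp (by fun_prop)
  have hmp := measurePreserving_replace (d := d) hα i
  have hi := hmp.integrable_comp_of_integrable (integrable_unifBox_of_continuous hα hc)
  have heq : ∀ (u : E d) (s : ℝ), w + EuclideanSpace.single i t + replace u i s =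
      replace (w + u) i (w i + (s + t)) := fun u s => by
    ext j
    rw [replace_apply]
    simp only [PiLp.add_apply, replace_apply]
    by_cases h : j = i
    · subst h; simp; ring
    · simp [h]
  have hi' : Integrable (fun z : E d × ℝ => f (replace (w + z.1) i (w i + (z.2 + t))))
      ((unifBox d α).prod (unifIcc (α / 2))) := by
    refine hi.congr (Eventually.of_forall fun z => ?_)
    simp only [Function.comp, heq]
  refine ⟨hi'.integral_prod_left, ?_⟩
  rw [← integral_prod _ hi', smooth]
  conv_lhs => rw [← hmp.map_eq]
  rw [integral_map hmp.measurable.aemeasurable hc.aestronglyMeasurable]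
  simp only [heq]

/-- The partial derivative is computed twice: from the gradient, and by differentiating the sliding
average under the outer integral. Derivatives are unique. -/
lemma smoothGrad_apply (hα : 0 < α) (hf : LipschitzWith C f) (w : E d) (i : Fin d) :
    smoothGrad α f w i = α⁻¹ * meanFaceDiff α f w i := by
  have := isProbabilityMeasure_unifBox (d := d) hα
  have := isProbabilityMeasure_unifIcc (half_pos hα)
  have h1 : HasDerivAt (fun t : ℝ => smooth α f (w + EuclideanSpace.single i t))
      (smoothGrad α f w i) 0 := by
    have hl : HasDerivAt (fun t : ℝ => w + EuclideanSpace.single i t)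
        (EuclideanSpace.single i (1 : ℝ)) 0 := by
      have hs : (fun t : ℝ => w + EuclideanSpace.single i t) =
          fun t => w + t • EuclideanSpace.single i (1 : ℝ) := by
        ext t j; simp
      rw [hs]
      simpa using
        ((hasDerivAt_id (0 : ℝ)).smul_const (EuclideanSpace.single i (1 : ℝ))).const_add w
    have hg := (hasGradientAt_smooth hα hf w).hasFDerivAt
    have hg' : HasFDerivAt (smooth α f) (InnerProductSpace.toDual ℝ (E d) (smoothGrad α f w))
        (w + EuclideanSpace.single i (0 : ℝ)) := by
      rwa [show w + EuclideanSpace.single i (0 : ℝ) = w by ext j; simp]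
    refine (hg'.comp_hasDerivAt 0 hl).congr_deriv ?_
    simp [InnerProductSpace.toDual_apply_apply, EuclideanSpace.inner_single_right]
  have hcont : ∀ u : E d, Continuous fun s : ℝ => f (replace (w + u) i (w i + s)) := fun u =>
    hf.continuous.comp ((continuous_replace i).comp
      (show Continuous fun s : ℝ => (w + u, w i + s) by fun_prop))
  have hcont' : ∀ (u : E d) t, Continuous fun s : ℝ => f (replace (w + u) i (w i + (s + t))) :=
    fun u t => (hcont u).comp (by fun_prop)
  have hcu : ∀ s : ℝ, Continuous fun u : E d => f (replace (w + u) i s) := fun s =>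
    hf.continuous.comp ((continuous_replace i).comp
      (show Continuous fun u : E d => (w + u, s) by fun_prop))
  have h2 := (hasDerivAt_integral_of_dominated_loc_of_lip (𝕜 := ℝ) (μ := unifBox d α)
    (F := fun t u => ∫ s, f (replace (w + u) i (w i + (s + t))) ∂unifIcc (α / 2))
    (F' := fun u => α⁻¹ * (f (replace (w + u) i (w i + α / 2)) -
      f (replace (w + u) i (w i + -(α / 2)))))
    (x₀ := 0) (bound := fun _ => (C : ℝ)) (s := Set.univ) univ_mem
    (Eventually.of_forall fun t => (smooth_add_single hα hf w i t).1.aestronglyMeasurable)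
    (smooth_add_single hα hf w i 0).1
    (((hcu _).sub (hcu _)).const_mul α⁻¹).aestronglyMeasurable
    (Eventually.of_forall fun u => LipschitzOnWith.of_dist_le_mul fun x _ y _ => by
      rw [Real.dist_eq, ← integral_sub
        (integrable_unifIcc_of_continuous (half_pos hα) (hcont' u x))
        (integrable_unifIcc_of_continuous (half_pos hα) (hcont' u y)), ← Real.norm_eq_abs]
      refine (norm_integral_le_of_norm_le_const (C := C * dist x y)
        (Eventually.of_forall fun s => ?_)).trans (by simp)
      rw [← dist_eq_norm]
      refine (hf.dist_le_mul _ _).trans ?_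
      gcongr
      rw [dist_replace, dist_add_left, dist_add_left])
    (integrable_const _)
    (Eventually.of_forall fun u => hasDerivAt_slidingAverage hα (hcont u))).2
  have h3 : (fun t : ℝ => smooth α f (w + EuclideanSpace.single i t)) = fun t =>
      ∫ u, ∫ s, f (replace (w + u) i (w i + (s + t))) ∂unifIcc (α / 2) ∂unifBox d α :=
    funext fun t => (smooth_add_single hα hf w i t).2
  rw [h3] at h1
  rw [h1.unique h2, integral_const_mul]
  simp only [meanFaceDiff, sub_eq_add_neg]

/-- Each component is `α⁻¹` times a mean of differences of two `C`-Lipschitz functions of `w`;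
collecting `d` components costs `√d`. -/
lemma norm_smoothGrad_sub_le (hα : 0 < α) (hf : LipschitzWith C f) (w w' : E d) :
    ‖smoothGrad α f w - smoothGrad α f w'‖ ≤ 2 * α⁻¹ * √(d : ℝ) * C * ‖w - w'‖ := by
  have := isProbabilityMeasure_unifBox (d := d) hα
  have hcu : ∀ (w : E d) (i : Fin d) (s : ℝ), Continuous fun u : E d => f (replace (w + u) i s) :=
    fun w i s => hf.continuous.comp ((continuous_replace i).comp
      (show Continuous fun u : E d => (w + u, s) by fun_prop))
  have hi : ∀ (w : E d) (i : Fin d) (s : ℝ),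
      Integrable (fun u : E d => f (replace (w + u) i s)) (unifBox d α) := fun w i s =>
    integrable_unifBox_of_continuous hα (hcu w i s)
  refine (norm_le_of_forall_abs_le (r := α⁻¹ * (2 * C * ‖w - w'‖)) (by positivity)
    fun i => ?_).trans_eq (by ring)
  rw [PiLp.sub_apply, smoothGrad_apply hα hf, smoothGrad_apply hα hf, ← mul_sub, abs_mul,
    abs_of_pos (inv_pos.2 hα)]
  refine mul_le_mul_of_nonneg_left ?_ (inv_pos.2 hα).le
  have hid : ∀ w : E d, Integrable (fun u : E d => f (replace (w + u) i (w i + α / 2)) -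
      f (replace (w + u) i (w i - α / 2))) (unifBox d α) := fun w => (hi _ _ _).sub (hi _ _ _)
  rw [meanFaceDiff, meanFaceDiff, ← integral_sub (hid w) (hid w'), ← Real.norm_eq_abs]
  refine (norm_integral_le_of_norm_le_const (C := 2 * C * ‖w - w'‖)
        (Eventually.of_forall fun u => ?_)).trans (by simp)
  -- The two arguments differ by exactly `w - w'`: the common `u` cancels off coordinate `i`, the
  -- common `t` on it.
  have hs : ∀ t : ℝ, |f (replace (w + u) i (w i + t)) - f (replace (w' + u) i (w' i + t))| ≤
      C * ‖w - w'‖ := fun t => by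
    rw [← Real.dist_eq]
    refine (hf.dist_le_mul _ _).trans (le_of_eq ?_)
    rw [dist_eq_norm]
    congr 2
    ext j
    simp only [PiLp.sub_apply, replace_apply, PiLp.add_apply]
    by_cases h : j = i
    · subst h; simp
    · simp [h]
  have h1 := abs_le.1 (hs (α / 2))
  have h2 := abs_le.1 (hs (-(α / 2)))
  rw [Real.norm_eq_abs, abs_le]
  simp only [← sub_eq_add_neg] at h2
  constructor <;> linarith [h1.1, h1.2, h2.1, h2.2]

end Smoothing

/-! ### Globally defined losses -/

/-- A stochastic loss that satisfies the Lipschitz assumption on the whole space. -/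
structure GlobalLoss {d p : ℕ} (μ : Measure (E p)) (F : E d → E p → ℝ) (L : E p → ℝ) : Prop where
  measurable_loss : Measurable fun z : E d × E p => F z.1 z.2
  integrable_loss : ∀ w, Integrable (F w) μ
  lip_nonneg : ∀ᵐ ξ ∂μ, 0 ≤ L ξ
  lipschitz_loss : ∀ᵐ ξ ∂μ, ∀ w w', |F w ξ - F w' ξ| ≤ L ξ * ‖w - w'‖
  integrable_lip : Integrable L μ
  sq_integrable_lip : Integrable (fun ξ => L ξ ^ 2) μ

lemma LossAssumptions.globalLoss {d p : ℕ} {μ : Measure (E p)} [IsProbabilityMeasure μ]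
    {κ : ℝ≥0∞} {F : E d → E p → ℝ} {L : E p → ℝ} (hF : LossAssumptions μ κ F L) (hd : d ≠ 0)
    (hκ : 0 < κ) {c : E d → E d} (hc : LipschitzWith 1 c) (hcκ : ∀ w, c w ∈ box d κ) :
    GlobalLoss μ (fun w => F (c w)) L := by
  -- Nonnegativity of `L` is not assumed; it follows by comparing the values of `F` at `0` and at a
  -- nonzero point of the box, which exists because `d ≠ 0` and `κ > 0`.
  have hnn : ∀ᵐ ξ ∂μ, 0 ≤ L ξ := by
    obtain ⟨r, hr0, hrκ⟩ := ENNReal.lt_iff_exists_nnreal_btwn.1 hκ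
    have hr : 0 < (r : ℝ) := by exact_mod_cast hr0
    set e : E d := EuclideanSpace.single ⟨0, Nat.pos_of_ne_zero hd⟩ (r : ℝ)
    have hn : ‖e‖ = r := by simp [e]
    have he : e ∈ box d κ := by
      refine box_mono d ?_ (mem_box_of_norm_le hn.le)
      rw [ENNReal.ofReal_coe_nnreal]; exact hrκ.le
    have h0 : (0 : E d) ∈ box d κ := fun i => by simp
    filter_upwards [hF.lipschitz_loss] with ξ hξ
    have := (abs_nonneg _).trans (hξ e he 0 h0)
    rw [sub_zero, hn] at this
    exact nonneg_of_mul_nonneg_left this hr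
  refine ⟨?_, fun w => hF.integrable_loss _ (hcκ w), hnn, ?_, ?_, hF.sq_integrable_lip⟩
  · have hm : Measurable fun z : E d × E p => ((⟨c z.1, hcκ z.1⟩ : box d κ), z.2) :=
      ((hc.continuous.measurable.comp measurable_fst).subtype_mk).prodMk measurable_snd
    exact hF.measurable_loss.comp hm
  · filter_upwards [hF.lipschitz_loss, hnn] with ξ hξ h0 w w'
    refine (hξ _ (hcκ w) _ (hcκ w')).trans (mul_le_mul_of_nonneg_left ?_ h0)
    simpa [dist_eq_norm] using hc.dist_le_mul w w'
  · have : MemLp L 2 μ :=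
      (memLp_two_iff_integrable_sq hF.measurable_lip.aestronglyMeasurable).2 hF.sq_integrable_lip
    exact this.integrable one_le_two

namespace GlobalLoss

variable {d p : ℕ} {μ : Measure (E p)} {F : E d → E p → ℝ} {L : E p → ℝ}

lemma lipschitzWith_loss (hF : GlobalLoss μ F L) :
    LipschitzWith (∫ ξ, L ξ ∂μ).toNNReal (loss μ F) := by
  refine LipschitzWith.of_dist_le_mul fun x y => ?_
  rw [Real.dist_eq, dist_eq_norm, Real.coe_toNNReal _ (integral_nonneg_of_ae hF.lip_nonneg), loss,
    loss, ← integral_sub (hF.integrable_loss x) (hF.integrable_loss y), ← integral_mul_const]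
  refine (abs_integral_le_integral_abs).trans (integral_mono_ae
    ((hF.integrable_loss x).sub (hF.integrable_loss y)).abs (hF.integrable_lip.mul_const _) ?_)
  filter_upwards [hF.lipschitz_loss] with ξ hξ using hξ x y

variable [IsProbabilityMeasure μ] {α : ℝ}

/-- The bound `|F (s u) ξ| ≤ |F 0 ξ| + ‖s u‖ L ξ` is integrable: its last term is a product of
functions of independent variables. -/
lemma integrable_comp (hF : GlobalLoss μ F L) (hα : 0 < α) {s : E d → E d} (hs : Continuous s) :
    Integrable (fun z : E d × E p => F (s z.1) z.2) ((unifBox d α).prod μ) := by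
  have := isProbabilityMeasure_unifBox (d := d) hα
  have h0 : Integrable (fun z : E d × E p => F 0 z.2) ((unifBox d α).prod μ) :=
    (hF.integrable_loss 0).comp_snd _
  have h1 : Integrable (fun z : E d × E p => ‖s z.1‖ * L z.2) ((unifBox d α).prod μ) :=
    (integrable_unifBox_of_continuous hα hs.norm).mul_prod hF.integrable_lip
  refine (h0.norm.add h1).mono' (hF.measurable_loss.comp
    ((hs.measurable.comp measurable_fst).prodMk measurable_snd)).aestronglyMeasurable ?_
  filter_upwards [Measure.quasiMeasurePreserving_snd.ae hF.lipschitz_loss] with z hz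
  have h2 := hz (s z.1) 0
  rw [sub_zero] at h2
  have h3 := abs_add_le (F (s z.1) z.2 - F 0 z.2) (F 0 z.2)
  rw [sub_add_cancel] at h3
  simp only [Pi.add_apply, Real.norm_eq_abs]
  linarith [mul_comm (L z.2) ‖s z.1‖]

end GlobalLoss

/-! ### One-sample estimators -/

/-- `h` is, for every `w ∈ B`, an unbiased estimator of `G w` whose squared norm is dominated by
`υ L²`. -/
structure IsUnbiasedOn {d p : ℕ} (μ : Measure (E p)) (α : ℝ) (B : Set (E d)) (L : E p → ℝ)
    (G : E d → E d) (υ : ℝ) (h : E d → E d → E p → E d) : Prop where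
  measurable : Measurable fun z : E d × E d × E p => h z.1 z.2.1 z.2.2
  mean : ∀ w ∈ B, ∫ z, h w z.1 z.2 ∂(unifBox d α).prod μ = G w
  sq_norm_le : ∀ w ∈ B, ∀ᵐ z ∂(unifBox d α).prod μ, ‖h w z.1 z.2‖ ^ 2 ≤ υ * L z.2 ^ 2

lemma half_le_sqrt_mul {d : ℕ} (hd : d ≠ 0) {α : ℝ} (hα : 0 < α) :
    α / 2 ≤ √(d : ℝ) * (α / 2) := by
  have : (1 : ℝ) ≤ √(d : ℝ) :=
    Real.one_le_sqrt.2 (by exact_mod_cast Nat.one_le_iff_ne_zero.2 hd)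
  nlinarith

section Estimators

variable {d p : ℕ} {μ : Measure (E p)} [IsProbabilityMeasure μ] {F : E d → E p → ℝ}
  {L : E p → ℝ} {α : ℝ}

lemma finDiff_apply (α : ℝ) (F : E d → E p → ℝ) (w u : E d) (ξ : E p) (i : Fin d) :
    finDiff α F w u ξ i =
      F (replace (w + u) i (w i + α / 2)) ξ - F (replace (w + u) i (w i - α / 2)) ξ := rfl

/-- The two points in each component are `α` apart, so after scaling each component is at most `L`
and the norm at most `√d L`; this is where `υ = d` comes from. The mean is Fubini plus
`smoothGrad_apply`. -/
lemma isUnbiasedOn_finDiff (hF : GlobalLoss μ F L) (hα : 0 < α) (B : Set (E d)) :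
    IsUnbiasedOn μ α B L (smoothGrad α (loss μ F)) d fun w u ξ => α⁻¹ • finDiff α F w u ξ := by
  have := isProbabilityMeasure_unifBox (d := d) hα
  have hm : Measurable fun z : E d × E d × E p => α⁻¹ • finDiff α F z.1 z.2.1 z.2.2 := by
    refine Measurable.const_smul ?_ α⁻¹
    refine (WithLp.measurable_toLp 2 _).comp (measurable_pi_lambda _ fun i => ?_)
    have hr : ∀ t : ℝ, Measurable fun z : E d × E d × E p =>
        F (replace (z.1 + z.2.1) i (z.1 i + t)) z.2.2 := fun t => by
      have hc : Continuous fun z : E d × E d × E p => replace (z.1 + z.2.1) i (z.1 i + t) :=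
        (continuous_replace i).comp
          (show Continuous fun z : E d × E d × E p => (z.1 + z.2.1, z.1 i + t) by fun_prop)
      exact hF.measurable_loss.comp (hc.measurable.prodMk (by fun_prop))
    have h2 := hr (-(α / 2))
    simp only [← sub_eq_add_neg] at h2
    exact (hr (α / 2)).sub h2
  have hle : ∀ w, ∀ᵐ z ∂(unifBox d α).prod μ,
      ‖α⁻¹ • finDiff α F w z.1 z.2‖ ≤ √(d : ℝ) * L z.2 := fun w => by
    filter_upwards [Measure.quasiMeasurePreserving_snd.ae hF.lipschitz_loss,
      Measure.quasiMeasurePreserving_snd.ae hF.lip_nonneg] with z hz h0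
    refine norm_le_of_forall_abs_le h0 fun i => ?_
    rw [PiLp.smul_apply, smul_eq_mul, abs_mul, abs_of_pos (inv_pos.2 hα), finDiff_apply,
      inv_mul_le_iff₀ hα]
    refine (hz _ _).trans_eq ?_
    rw [← dist_eq_norm, dist_replace, Real.dist_eq, show w i + α / 2 - (w i - α / 2) = α by ring,
      abs_of_pos hα, mul_comm]
  refine ⟨hm, fun w _ => ?_, fun w _ => ?_⟩
  · have hi : Integrable (fun z : E d × E p => α⁻¹ • finDiff α F w z.1 z.2)
        ((unifBox d α).prod μ) :=
      ((hF.integrable_lip.comp_snd _).const_mul √(d : ℝ)).mono'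
        (hm.comp measurable_prodMk_left).aestronglyMeasurable (hle w)
    ext i
    have hc : ∀ t : ℝ, Continuous fun u : E d => replace (w + u) i t := fun t =>
      (continuous_replace i).comp (show Continuous fun u : E d => (w + u, t) by fun_prop)
    have hI := fun t => hF.integrable_comp (α := α) hα (hc t)
    rw [eval_integral_piLp (fun i => hi.eval_piLp i),
      smoothGrad_apply hα hF.lipschitzWith_loss]
    simp only [PiLp.smul_apply, smul_eq_mul, finDiff_apply]
    have hId : Integrable (fun z : E d × E p => F (replace (w + z.1) i (w i + α / 2)) z.2 -
        F (replace (w + z.1) i (w i - α / 2)) z.2) ((unifBox d α).prod μ) := (hI _).sub (hI _)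
    rw [integral_const_mul, integral_prod _ hId, meanFaceDiff]
    congr 2
    ext u
    exact integral_sub (hF.integrable_loss (replace (w + u) i (w i + α / 2)))
      (hF.integrable_loss (replace (w + u) i (w i - α / 2)))
  · filter_upwards [hle w] with z hz
    have := pow_le_pow_left₀ (norm_nonneg _) hz 2
    rwa [mul_pow, Real.sq_sqrt (Nat.cast_nonneg d)] at this

lemma smooth_loss_eq_integral_prod (hF : GlobalLoss μ F L) (hα : 0 < α) (w : E d) :
    smooth α (loss μ F) w = ∫ z, F (w + z.1) z.2 ∂(unifBox d α).prod μ := by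
  have := isProbabilityMeasure_unifBox (d := d) hα
  rw [integral_prod _ (hF.integrable_comp hα (continuous_const_add w))]
  rfl

/-- Differentiating `𝔼[F (w + u, ξ)]` under the joint law gives a second expression for the gradient
of the smoothing. Its integrand is bounded by the Lipschitz constant, whence `υ = 1`. -/
lemma isUnbiasedOn_gradient (hF : GlobalLoss μ F L) (hα : 0 < α) {B : Set (E d)}
    {h : E d → E d → E p → E d} (hm : Measurable fun z : E d × E d × E p => h z.1 z.2.1 z.2.2)
    (hg : ∀ w ∈ B, ∀ᵐ z ∂(unifBox d α).prod μ,
      HasGradientAt (fun v => F v z.2) (h w z.1 z.2) (w + z.1)) :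
    IsUnbiasedOn μ α B L (smoothGrad α (loss μ F)) 1 h := by
  have := isProbabilityMeasure_unifBox (d := d) hα
  refine ⟨hm, fun w hw => ?_, fun w hw => ?_⟩
  · have h1 := (hasGradientAt_integral (ν := (unifBox d α).prod μ)
      (H := fun x z => F (x + z.1) z.2) (H' := fun z => h w z.1 z.2) (bound := fun z => L z.2)
      (x₀ := w) (fun x => hF.integrable_comp hα (continuous_const_add x))
      (hm.comp measurable_prodMk_left).aestronglyMeasurable (by
        filter_upwards [Measure.quasiMeasurePreserving_snd.ae hF.lipschitz_loss] with z hz x y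
        simpa using hz (x + z.1) (y + z.1)) (hF.integrable_lip.comp_snd _) (by
        filter_upwards [hg w hw] with z hz
        rw [hasGradientAt_iff_hasFDerivAt] at hz ⊢
        exact (hz.comp w ((hasFDerivAt_id w).add_const z.1)).congr_fderiv
          (ContinuousLinearMap.comp_id _))).2
    simp only [← smooth_loss_eq_integral_prod hF hα] at h1
    exact h1.unique (hasGradientAt_smooth hα hF.lipschitzWith_loss w)
  · filter_upwards [hg w hw, Measure.quasiMeasurePreserving_snd.ae hF.lipschitz_loss,
      Measure.quasiMeasurePreserving_snd.ae hF.lip_nonneg] with z hz hl h0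
    have h2 : ‖h w z.1 z.2‖ ≤ L z.2 := by
      have := hz.hasFDerivAt.le_of_lip' h0 (Eventually.of_forall fun x => hl x (w + z.1))
      simpa using this
    rw [one_mul]
    exact pow_le_pow_left₀ (norm_nonneg _) h2 2

/-- Either estimator agrees on the relevant points with an everywhere measurable one, which is
unbiased for the gradient of the smoothing of the extended loss. -/
lemma IsEstimator.exists_isUnbiasedOn {κ β : ℝ≥0∞} {g : E d → E d → E p → E d} {υ : ℝ}
    (hg : IsEstimator μ α β F g υ) (hα : 0 < α)
    (hκ : β + ENNReal.ofReal (α / 2) < κ ∨ κ = ⊤) {c : E d → E d}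
    (hc : ∀ w ∈ box d κ, c w = w) (hF : GlobalLoss μ (fun w => F (c w)) L) :
    ∃ h : E d → E d → E p → E d,
      (∀ w ∈ box d β, ∀ u ∈ box d (ENNReal.ofReal (α / 2)), ∀ ξ, h w u ξ = g w u ξ) ∧
      IsUnbiasedOn μ α (box d β) L (smoothGrad α (loss μ fun w => F (c w))) υ h := by
  have hle : β + ENNReal.ofReal (α / 2) ≤ κ := by
    rcases hκ with h | h
    · exact h.le
    · simp [h]
  cases hg with
  | zerothOrder =>
    refine ⟨_, fun w hw u hu ξ => ?_, isUnbiasedOn_finDiff hF hα _⟩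
    congr 1
    ext i
    have hmem : ∀ t : ℝ, |t| ≤ α / 2 → replace (w + u) i (w i + t) ∈ box d κ := fun t ht => by
      refine box_mono d hle ?_
      have : replace (w + u) i (w i + t) = w + replace u i t := by
        ext j
        simp only [PiLp.add_apply, replace_apply]
        by_cases h : j = i
        · subst h; simp
        · simp [h]
      rw [this]
      refine add_mem_box hw ((mem_box_ofReal (by positivity)).2 fun j => ?_)
      rw [replace_apply]
      split_ifs
      · exact ht
      · exact (mem_box_ofReal (by positivity)).1 hu j
    have ha : |α / 2| ≤ α / 2 := (abs_of_pos (half_pos hα)).le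
    rw [finDiff_apply, finDiff_apply, hc _ (hmem _ ha), sub_eq_add_neg (w i),
      hc _ (hmem _ (by rwa [abs_neg]))]
  | firstOrder gradF hG =>
    set b := box d (β + ENNReal.ofReal (α / 2)) with hb
    have hemb : MeasurableEmbedding (Prod.map ((↑) : b → E d) (id : E p → E p)) :=
      (MeasurableEmbedding.subtype_coe (isClosed_box _ _).measurableSet).prodMap
        MeasurableEmbedding.id
    -- `gradF` is measurable only on a box, so it is replaced by a globally measurable extension
    -- that agrees with it there.
    obtain ⟨G, hGm, hGe⟩ := hemb.exists_measurable_extend hG.measurable_grad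
      (fun _ => inferInstance)
    have hval : ∀ x ∈ b, ∀ ξ, G (x, ξ) = gradF x ξ := fun x hx ξ =>
      congrFun hGe (⟨x, hx⟩, ξ)
    refine ⟨fun w u ξ => G (w + u, ξ), fun w hw u hu ξ => hval _ (add_mem_box hw hu) ξ,
      isUnbiasedOn_gradient hF hα (hGm.comp (by fun_prop)) fun w hw => ?_⟩
    filter_upwards [hG.ae_eq_grad w hw,
      Measure.quasiMeasurePreserving_fst.ae (ae_mem_box d α)] with z hz hzb
    have hmem : w + z.1 ∈ b := add_mem_box hw hzb
    rw [hval _ hmem]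
    refine hz.congr_of_eventuallyEq ?_
    -- The retraction is the identity near `w + u`, hence leaves the gradient there unchanged.
    filter_upwards [box_mem_nhds hκ hmem] with x hx
    rw [hc x hx]

end Estimators

/-! ### Mini-batches -/

section Batches

variable {d : ℕ} {X : Type*} [MeasurableSpace X] {lam : Measure X} [IsProbabilityMeasure lam]
  {M : ℕ} {ψ : X → E d} {B : ℝ}

lemma sq_norm_sum_le {ι V : Type*} [Fintype ι] [NormedAddCommGroup V] (v : ι → V) :
    ‖∑ i, v i‖ ^ 2 ≤ Fintype.card ι * ∑ i, ‖v i‖ ^ 2 :=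
  (pow_le_pow_left₀ (norm_nonneg _) (norm_sum_le _ _) 2).trans
    (by simpa using sq_sum_le_card_mul_sum_sq (s := Finset.univ) (f := fun i => ‖v i‖))

/-- By Cauchy–Schwarz the squared norm of an average is at most the average of the squared norms. -/
lemma lintegral_sq_norm_batch_le (hM : 0 < M) (hψ : Measurable ψ)
    (hi : Integrable (fun x => ‖ψ x‖ ^ 2) lam) (hB : ∫ x, ‖ψ x‖ ^ 2 ∂lam ≤ B) :
    ∫⁻ x, ENNReal.ofReal (‖(M : ℝ)⁻¹ • ∑ i : Fin M, ψ (x i)‖ ^ 2) ∂Measure.pi (fun _ => lam) ≤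
      ENNReal.ofReal B := by
  have hMr : (0 : ℝ) < M := by exact_mod_cast hM
  have hI : ∀ i : Fin M, Integrable (fun x : Fin M → X => ‖ψ (x i)‖ ^ 2)
      (Measure.pi fun _ => lam) := fun i =>
    (measurePreserving_eval (fun _ : Fin M => lam) i).integrable_comp_of_integrable hi
  have hE : ∀ i : Fin M, ∫ x : Fin M → X, ‖ψ (x i)‖ ^ 2 ∂Measure.pi (fun _ => lam) =
      ∫ x, ‖ψ x‖ ^ 2 ∂lam := fun i => by
    have hmp := measurePreserving_eval (fun _ : Fin M => lam) i
    conv_rhs => rw [← hmp.map_eq]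
    rw [integral_map hmp.measurable.aemeasurable (hψ.norm.pow_const 2).aestronglyMeasurable]
  calc _ ≤ ∫⁻ x, ENNReal.ofReal ((M : ℝ)⁻¹ * ∑ i : Fin M, ‖ψ (x i)‖ ^ 2)
        ∂Measure.pi (fun _ => lam) := lintegral_mono fun x => by
        refine ENNReal.ofReal_le_ofReal ?_
        have := sq_norm_sum_le fun i : Fin M => ψ (x i)
        rw [Fintype.card_fin] at this
        rw [norm_smul, mul_pow, norm_inv, Real.norm_of_nonneg hMr.le, inv_pow, sq (M : ℝ),
          inv_mul_le_iff₀ (by positivity)]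
        refine this.trans_eq ?_
        field_simp
    _ = ENNReal.ofReal (∫ x, (M : ℝ)⁻¹ * ∑ i : Fin M, ‖ψ (x i)‖ ^ 2
        ∂Measure.pi (fun _ => lam)) := by
        rw [ofReal_integral_eq_lintegral_ofReal
          ((integrable_finsetSum _ fun i _ => hI i).const_mul _)
          (Eventually.of_forall fun x => by positivity)]
    _ ≤ ENNReal.ofReal B := by
        refine ENNReal.ofReal_le_ofReal ?_
        rw [integral_const_mul, integral_finsetSum _ fun i _ => hI i]
        simp only [hE, Finset.sum_const, Finset.card_univ, Fintype.card_fin, nsmul_eq_mul]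
        rwa [inv_mul_cancel_left₀ hMr.ne']

/-- Variances of independent samples add, so averaging gains `1 / M` in each coordinate; each
variance is then bounded by a second moment. -/
lemma lintegral_sq_norm_batch_sub_mean_le (hM : 0 < M) (hψ : Measurable ψ)
    (hi : Integrable (fun x => ‖ψ x‖ ^ 2) lam) (hB : ∫ x, ‖ψ x‖ ^ 2 ∂lam ≤ B) :
    ∫⁻ x, ENNReal.ofReal (‖(M : ℝ)⁻¹ • ∑ i : Fin M, ψ (x i) - ∫ y, ψ y ∂lam‖ ^ 2)
      ∂Measure.pi (fun _ => lam) ≤ ENNReal.ofReal (B / M) := by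
  have hMr : (0 : ℝ) < M := by exact_mod_cast hM
  have hL2 : MemLp ψ 2 lam := (memLp_two_iff_integrable_sq_norm hψ.aestronglyMeasurable).2 hi
  have hL2j : ∀ j, MemLp (fun x => ψ x j) 2 lam := fun j => hL2.eval_piLp j
  have hψj : ∀ j, Measurable fun x => ψ x j := fun j => by fun_prop
  set Z : Fin d → (Fin M → X) → ℝ := fun j x => ∑ i, (M : ℝ)⁻¹ * ψ (x i) j with hZ
  have hZL : ∀ j, MemLp (Z j) 2 (Measure.pi fun _ => lam) := fun j =>
    memLp_finsetSum _ fun i _ => ((hL2j j).const_mul _).comp_measurePreserving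
      (measurePreserving_eval (fun _ : Fin M => lam) i)
  have hZE : ∀ j, ∫ x, Z j x ∂Measure.pi (fun _ => lam) = ∫ y, ψ y j ∂lam := fun j => by
    have hmp := fun i => measurePreserving_eval (fun _ : Fin M => lam) i
    have hI : ∀ i : Fin M, Integrable (fun x : Fin M → X => (M : ℝ)⁻¹ * ψ (x i) j)
        (Measure.pi fun _ => lam) := fun i =>
      (((hL2j j).const_mul _).comp_measurePreserving (hmp i)).integrable one_le_two
    rw [integral_finsetSum _ fun i _ => hI i]
    have : ∀ i : Fin M, ∫ x : Fin M → X, (M : ℝ)⁻¹ * ψ (x i) j ∂Measure.pi (fun _ => lam) =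
        (M : ℝ)⁻¹ * ∫ y, ψ y j ∂lam := fun i => by
      rw [integral_const_mul]
      conv_rhs => rw [← (hmp i).map_eq]
      rw [integral_map (hmp i).measurable.aemeasurable (hψj j).aestronglyMeasurable]
    simp only [this, Finset.sum_const, Finset.card_univ, Fintype.card_fin, nsmul_eq_mul]
    rw [mul_inv_cancel_left₀ hMr.ne']
  have hZV : ∀ j, ∫ x, (Z j x - ∫ y, ψ y j ∂lam) ^ 2 ∂Measure.pi (fun _ => lam) ≤
      (M : ℝ)⁻¹ * ∫ y, ψ y j ^ 2 ∂lam := fun j => by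
    have h1 := variance_eq_integral (hZL j).aestronglyMeasurable.aemeasurable
    rw [hZE j] at h1
    rw [← h1]
    have h2 := variance_sum_pi (μ := fun _ : Fin M => lam)
      (X := fun _ x => (M : ℝ)⁻¹ * ψ x j) fun i => (hL2j j).const_mul _
    have h3 : Z j = ∑ i : Fin M, fun x : Fin M → X => (M : ℝ)⁻¹ * ψ (x i) j := by
      ext x; simp [hZ]
    rw [h3, h2]
    simp only [variance_const_mul, Finset.sum_const, Finset.card_univ, Fintype.card_fin,
      nsmul_eq_mul]
    have h4 : Var[fun x => ψ x j; lam] ≤ ∫ y, ψ y j ^ 2 ∂lam :=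
      variance_le_expectation_sq (hψj j).aestronglyMeasurable
    calc (M : ℝ) * ((M : ℝ)⁻¹ ^ 2 * Var[fun x => ψ x j; lam])
        = (M : ℝ)⁻¹ * Var[fun x => ψ x j; lam] := by field_simp
      _ ≤ _ := mul_le_mul_of_nonneg_left h4 (by positivity)
  have hZi : ∀ j, Integrable (fun x => (Z j x - ∫ y, ψ y j ∂lam) ^ 2)
      (Measure.pi fun _ : Fin M => lam) := fun j =>
    ((hZL j).sub (memLp_const _)).integrable_sq
  have hnorm : ∀ x : Fin M → X, ‖(M : ℝ)⁻¹ • ∑ i : Fin M, ψ (x i) - ∫ y, ψ y ∂lam‖ ^ 2 =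
      ∑ j, (Z j x - ∫ y, ψ y j ∂lam) ^ 2 := fun x => by
    rw [EuclideanSpace.norm_sq_eq]
    refine Finset.sum_congr rfl fun j _ => ?_
    rw [Real.norm_eq_abs, sq_abs, PiLp.sub_apply,
      eval_integral_piLp fun j => (hL2j j).integrable one_le_two]
    simp [hZ, Finset.mul_sum]
  simp only [hnorm]
  rw [← ofReal_integral_eq_lintegral_ofReal (integrable_finsetSum _ fun j _ => hZi j)
    (Eventually.of_forall fun x => Finset.sum_nonneg fun j _ => sq_nonneg _)]
  refine ENNReal.ofReal_le_ofReal ?_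
  rw [integral_finsetSum _ fun j _ => hZi j]
  refine (Finset.sum_le_sum fun j _ => hZV j).trans ?_
  rw [← Finset.mul_sum, ← integral_finsetSum _ fun j _ => (hL2j j).integrable_sq,
    div_eq_inv_mul]
  refine mul_le_mul_of_nonneg_left (le_trans (le_of_eq ?_) hB) (by positivity)
  refine integral_congr_ae (Eventually.of_forall fun x => ?_)
  simp [EuclideanSpace.norm_sq_eq]

end Batches

/-! ### One step of the projected method -/

/-- Energy estimate for one inexact projected gradient step: `y` is at least as close to
`x - η g` as `x` is. -/
lemma sq_norm_stationarity_le {d : ℕ} {φ : E d → ℝ} {G : E d → E d} {Λ ρ τ η : ℝ} (hΛ : 0 < Λ)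
    (hφ : ∀ z, HasGradientAt φ (G z) z) (hG : ∀ z z', ‖G z - G z'‖ ≤ Λ * ‖z - z'‖)
    (hρ : 0 < ρ) (hτ : 0 ≤ τ) (hρτ : 1 < ρ + τ) (hη : η = 2 / (3 * ρ * Λ)) {x y g : E d}
    (hy : ‖y - (x - η • g)‖ ≤ ‖x - (x - η • g)‖) :
    ‖G y - g - η⁻¹ • (y - x)‖ ^ 2 ≤ C₁ ρ τ * Λ * (φ x - φ y) +
      ((2 * (1 + 3 * ρ) / (τ + ρ - 1) + 3) * ‖g - G x‖ ^ 2 +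
        2 * (1 + 3 * ρ) / (τ + ρ - 1) * (4 / 3 * (τ / ρ ^ 2)) * ‖g‖ ^ 2) := by
  have hη0 : 0 < η := by rw [hη]; positivity
  have hηinv : η⁻¹ = 3 * ρ * Λ / 2 := by rw [hη, inv_div]
  have hs : 0 < τ + ρ - 1 := by linarith
  set v := y - x with hv
  set e := g - G x with he
  set V := ‖v‖ ^ 2 with hV
  have hy' : ‖v + η • g‖ ≤ η * ‖g‖ := by
    have h1 : y - (x - η • g) = v + η • g := by rw [hv]; abel
    have h2 : x - (x - η • g) = η • g := by abel
    rwa [h1, h2, norm_smul, Real.norm_of_nonneg hη0.le] at hy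
  -- Squaring `hy'` gives `2 η ⟨g, v⟩ ≤ -V`.
  have hgv : inner ℝ g v ≤ -(3 * ρ * Λ / 4) * V := by
    have h1 := pow_le_pow_left₀ (norm_nonneg _) hy' 2
    rw [norm_add_sq_real, norm_smul, Real.norm_of_nonneg hη0.le, real_inner_smul_right,
      real_inner_comm] at h1
    have h2 : η * (2 * inner ℝ g v) ≤ η * (-(η⁻¹ * V)) := by
      rw [mul_neg, mul_inv_cancel_left₀ hη0.ne']; linarith
    have h3 := le_of_mul_le_mul_left h2 hη0
    rw [hηinv] at h3
    linarith
  -- The step has length at most `2 η ‖g‖`.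
  have hVg : Λ ^ 2 * V ≤ 16 / 9 * (‖g‖ ^ 2 / ρ ^ 2) := by
    have h1 : ‖v‖ ≤ 2 * η * ‖g‖ := by
      have := norm_sub_le (v + η • g) (η • g)
      rw [add_sub_cancel_right, norm_smul, Real.norm_of_nonneg hη0.le] at this
      linarith
    have h2 := mul_le_mul_of_nonneg_left (pow_le_pow_left₀ (norm_nonneg _) h1 2) (sq_nonneg Λ)
    refine h2.trans_eq ?_
    rw [hη]; field_simp; ring
  have hup := (abs_le.1 (abs_sub_sub_inner_le hφ hG x y)).2
  have hlow := (abs_le.1 (abs_sub_sub_inner_le hφ hG y x)).1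
  rw [norm_sub_rev x y, ← neg_sub y x, inner_neg_right] at hlow
  have hGx : inner ℝ (G x) v = inner ℝ g v - inner ℝ e v := by
    rw [← inner_sub_left, he, sub_sub_cancel]
  have hev : -(Λ * inner ℝ e v) ≤ ‖e‖ ^ 2 + Λ ^ 2 / 4 * V := by
    have h1 := sq_nonneg ‖e + (Λ / 2) • v‖
    rw [norm_add_sq_real, norm_smul, real_inner_smul_right, mul_pow, Real.norm_eq_abs, sq_abs]
      at h1
    linarith
  -- The descent inequality with `hev` controls `3/4 (ρ - 1) Λ² V` only. Adding `τ` times `hVg`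
  -- makes the coefficient positive even for `ρ ≤ 1`, at the price of the term in `‖g‖²`.
  have hVb : (3 / 4) * (τ + ρ - 1) * (Λ ^ 2 * V) ≤
      Λ * (φ x - φ y) + ‖e‖ ^ 2 + 4 / 3 * (τ / ρ ^ 2) * ‖g‖ ^ 2 := by
    have h1 := mul_le_mul_of_nonneg_left hVg hτ
    have h2 : 4 / 3 * (τ / ρ ^ 2) * ‖g‖ ^ 2 = 3 / 4 * (τ * (16 / 9 * (‖g‖ ^ 2 / ρ ^ 2))) := by
      ring
    rw [h2]
    have h3 : φ y - φ x ≤ -(3 * ρ * Λ / 4) * V - inner ℝ e v + Λ / 2 * V := by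
      rw [hGx] at hup; linarith
    have h4 := mul_le_mul_of_nonneg_left h3 hΛ.le
    linarith
  have hGg : ‖G y - g‖ ^ 2 ≤ 3 / 2 * (Λ ^ 2 * V) + 3 * ‖e‖ ^ 2 := by
    have h0 : G y - g = (G y - G x) - e := by rw [he]; abel
    have h1 := pow_le_pow_left₀ (norm_nonneg _) (hG y x) 2
    have h2 := sq_nonneg ‖(G y - G x) + (2 : ℝ) • e‖
    rw [norm_add_sq_real, norm_smul, real_inner_smul_right, mul_pow, Real.norm_ofNat] at h2
    rw [h0, norm_sub_sq_real]
    rw [mul_pow] at h1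
    linarith
  -- Expanding the square, `η⁻² V = 9/4 ρ² Λ² V` cancels against the bound from `hgv`. The factor `1
  -- + ρ` would suffice here; `1 + 3 ρ` is the one in the stated constants.
  have hD : ‖G y - g - η⁻¹ • v‖ ^ 2 ≤
      3 / 2 * (1 + 3 * ρ) * (Λ ^ 2 * V) + 3 * ‖e‖ ^ 2 + 3 * ρ * Λ * (φ x - φ y) := by
    have hGy : -(inner ℝ (G y) v) ≤ φ x - φ y + Λ / 2 * V := by linarith
    have h1 : 0 ≤ 3 * ρ * Λ := by positivity
    have h2 := mul_le_mul_of_nonneg_left hGy h1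
    have h3 := mul_le_mul_of_nonneg_left hgv h1
    have h4 : 0 ≤ ρ * (Λ ^ 2 * V) := by positivity
    rw [norm_sub_sq_real, norm_smul, real_inner_smul_right, inner_sub_left, hηinv, mul_pow,
      Real.norm_eq_abs, sq_abs]
    linarith
  have hc : 0 ≤ 2 * (1 + 3 * ρ) / (τ + ρ - 1) := by positivity
  have hfin := mul_le_mul_of_nonneg_left hVb hc
  have h5 : 2 * (1 + 3 * ρ) / (τ + ρ - 1) * ((3 / 4) * (τ + ρ - 1) * (Λ ^ 2 * V)) =
      3 / 2 * (1 + 3 * ρ) * (Λ ^ 2 * V) := by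
    field_simp; ring
  rw [h5] at hfin
  rw [C₁]
  linarith

/-! ### Expectations along a run -/

/-- A bound that holds for every frozen state is inherited when the state is random and independent
of the samples. -/
lemma lintegral_le_of_indepFun {Ω T S : Type*} {mΩ : MeasurableSpace Ω} [MeasurableSpace T]
    [MeasurableSpace S] {P : Measure Ω} [IsProbabilityMeasure P] {W : Ω → T} {X : Ω → S}
    {π : Measure S} (hW : Measurable W) (hX : Measurable X) (hWX : IndepFun W X P)
    (hπ : P.map X = π) {Φ : T × S → ℝ≥0∞} (hΦ : Measurable Φ) {c : ℝ≥0∞}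
    (hc : ∀ᵐ ω ∂P, ∫⁻ x, Φ (W ω, x) ∂π ≤ c) : ∫⁻ ω, Φ (W ω, X ω) ∂P ≤ c := by
  have hp : IsProbabilityMeasure (P.map X) := Measure.isProbabilityMeasure_map hX.aemeasurable
  have h1 : ∫⁻ ω, Φ (W ω, X ω) ∂P = ∫⁻ z, Φ z ∂P.map (fun ω => (W ω, X ω)) :=
    (lintegral_map hΦ (hW.prodMk hX)).symm
  rw [hπ] at hp
  rw [h1, hWX.map_prod_eq_prod_map_map hW.aemeasurable hX.aemeasurable, hπ,
    lintegral_prod _ hΦ.aemeasurable, lintegral_map hΦ.lintegral_prod_right' hW]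
  exact (lintegral_mono_ae hc).trans (by simp)

/-- Expectation at an independent uniformly distributed index. -/
lemma lintegral_uniform_index_le {Ω : Type*} {m mΩ : MeasurableSpace Ω} {P : Measure Ω}
    [IsProbabilityMeasure P] {R : Ω → ℕ} {K : ℕ} (hK : 0 < K) (hR : Measurable R)
    (hunif : ∀ k ∈ Finset.Icc 2 (K + 1), P {ω | R ω = k} = (K : ℝ≥0∞)⁻¹)
    (hm : m ≤ mΩ) (hind : Indep (MeasurableSpace.comap R ⊤) m P)
    {H : ℕ → Ω → ℝ≥0∞} (hH : ∀ k < K, Measurable[m] (H k)) {Y : ℕ → Ω → ℝ≥0∞}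
    (hY : ∀ k < K, ∀ᵐ ω ∂P, Y (k + 2) ω ≤ H k ω) :
    ∫⁻ ω, Y (R ω) ω ∂P ≤ (K : ℝ≥0∞)⁻¹ * ∑ k ∈ Finset.range K, ∫⁻ ω, H k ω ∂P := by
  have hset : ∀ k, MeasurableSet (R ⁻¹' {k}) := fun k => hR (measurableSet_singleton k)
  have hunif' : ∀ k ∈ Finset.Icc 2 (K + 1), P (R ⁻¹' {k}) = (K : ℝ≥0∞)⁻¹ := hunif
  have hRm : ∀ᵐ ω ∂P, R ω ∈ Finset.Icc 2 (K + 1) := by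
    have hU : P (R ⁻¹' (Finset.Icc 2 (K + 1) : Finset ℕ)) = 1 := by
      rw [← sum_measure_preimage_singleton _ fun k _ => hset k, Finset.sum_congr rfl hunif']
      simp only [Finset.sum_const, Nat.card_Icc, nsmul_eq_mul]
      rw [show K + 1 + 1 - 2 = K by omega]
      exact ENNReal.mul_inv_cancel (by exact_mod_cast hK.ne') (ENNReal.natCast_ne_top K)
    have hmem := (mem_ae_iff_prob_eq_one (μ := P) (hR (Finset.measurableSet _))).2 hU
    filter_upwards [hmem] with ω hω using hω
  have hYall : ∀ᵐ ω ∂P, ∀ k ∈ Finset.range K, Y (k + 2) ω ≤ H k ω :=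
    (Finset.eventually_all _).2 fun k hk => hY k (Finset.mem_range.1 hk)
  -- `Y` need not be measurable, so it is dominated by the measurable `H` before independence of `R`
  -- is used. The shift by two matches the range of `R`.
  set I : ℕ → Ω → ℝ≥0∞ := fun k => (R ⁻¹' {k + 2}).indicator (fun _ => 1) with hI
  calc ∫⁻ ω, Y (R ω) ω ∂P
      ≤ ∫⁻ ω, ∑ k ∈ Finset.range K, I k ω * H k ω ∂P := by
        refine lintegral_mono_ae ?_
        filter_upwards [hRm, hYall] with ω hω hYω
        rw [Finset.mem_Icc] at hω
        obtain ⟨j, hj⟩ := Nat.exists_eq_add_of_le' hω.1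
        have hk : j ∈ Finset.range K := Finset.mem_range.2 (by omega)
        refine le_trans ?_ (Finset.single_le_sum (fun _ _ => zero_le) hk)
        have h2 : I j ω = 1 := Set.indicator_of_mem (show ω ∈ R ⁻¹' {j + 2} from hj) _
        rw [h2, one_mul, hj]
        exact hYω _ hk
    _ = ∑ k ∈ Finset.range K, ∫⁻ ω, I k ω * H k ω ∂P := by
        refine lintegral_finsetSum _ fun k hk => ?_
        exact (measurable_const.indicator (hset _)).mul
          ((hH k (Finset.mem_range.1 hk)).mono hm le_rfl)
    _ = ∑ k ∈ Finset.range K, (K : ℝ≥0∞)⁻¹ * ∫⁻ ω, H k ω ∂P := by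
        refine Finset.sum_congr rfl fun k hk => ?_
        have hk' := Finset.mem_range.1 hk
        have hIm : Measurable[MeasurableSpace.comap R ⊤] (I k) :=
          (@measurable_const _ _ _ (MeasurableSpace.comap R ⊤) _).indicator
            ⟨{k + 2}, trivial, rfl⟩
        rw [lintegral_mul_eq_lintegral_mul_lintegral_of_independent_measurableSpace
          hR.comap_le hm hind hIm (hH k hk'), hI, lintegral_indicator_const (hset _), one_mul,
          hunif' _ (Finset.mem_Icc.2 (by omega))]
    _ = _ := by rw [Finset.mul_sum]

/-- The mini-batch average of a one-sample estimator. -/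
noncomputable def batch {d p M : ℕ} (h : E d → E d → E p → E d) (w : E d)
    (x : Fin M → E d × E p) : E d :=
  (M : ℝ)⁻¹ • ∑ i, h w (x i).1 (x i).2

lemma measurable_batch {d p M : ℕ} {h : E d → E d → E p → E d}
    (hh : Measurable fun z : E d × E d × E p => h z.1 z.2.1 z.2.2) :
    Measurable fun z : E d × (Fin M → E d × E p) => batch h z.1 z.2 := by
  have hi : ∀ i : Fin M, Measurable fun z : E d × (Fin M → E d × E p) =>
      h z.1 (z.2 i).1 (z.2 i).2 := fun i =>
    hh.comp (show Measurable fun z : E d × (Fin M → E d × E p) =>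
    (z.1, (z.2 i).1, (z.2 i).2) by fun_prop)
  exact (Finset.measurable_fun_sum _ fun i _ => hi i).const_smul (M : ℝ)⁻¹

namespace IsUnbiasedOn

variable {d p M : ℕ} {μ : Measure (E p)} [IsProbabilityMeasure μ] {α : ℝ} {B : Set (E d)}
  {L : E p → ℝ} {G : E d → E d} {υ : ℝ} {h : E d → E d → E p → E d}

lemma second_moment (hh : IsUnbiasedOn μ α B L G υ h) (hα : 0 < α)
    (hL : Integrable (fun ξ => L ξ ^ 2) μ) {w : E d} (hw : w ∈ B) :
    Integrable (fun z : E d × E p => ‖h w z.1 z.2‖ ^ 2) ((unifBox d α).prod μ) ∧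
      ∫ z, ‖h w z.1 z.2‖ ^ 2 ∂(unifBox d α).prod μ ≤ υ * ∫ ξ, L ξ ^ 2 ∂μ := by
  have := isProbabilityMeasure_unifBox (d := d) hα
  have hm : Measurable fun z : E d × E p => h w z.1 z.2 := hh.measurable.comp measurable_prodMk_left
  have hL' : Integrable (fun z : E d × E p => υ * L z.2 ^ 2) ((unifBox d α).prod μ) :=
    (hL.comp_snd _).const_mul υ
  have hi : Integrable (fun z : E d × E p => ‖h w z.1 z.2‖ ^ 2) ((unifBox d α).prod μ) :=
    hL'.mono' (hm.norm.pow_const 2).aestronglyMeasurable ((hh.sq_norm_le w hw).mono fun z hz => by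
      rwa [Real.norm_of_nonneg (by positivity)])
  refine ⟨hi, (integral_mono_ae hi hL' (hh.sq_norm_le w hw)).trans_eq ?_⟩
  rw [integral_const_mul, integral_fun_snd (f := fun ξ => L ξ ^ 2)]
  simp

lemma lintegral_batch_le (hh : IsUnbiasedOn μ α B L G υ h) (hα : 0 < α)
    (hL : Integrable (fun ξ => L ξ ^ 2) μ) (hM : 0 < M) {w : E d} (hw : w ∈ B) :
    ∫⁻ x : Fin M → E d × E p, ENNReal.ofReal (‖batch h w x‖ ^ 2)
      ∂Measure.pi (fun _ => (unifBox d α).prod μ) ≤ ENNReal.ofReal (υ * ∫ ξ, L ξ ^ 2 ∂μ) := by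
  have := isProbabilityMeasure_unifBox (d := d) hα
  obtain ⟨h1, h2⟩ := hh.second_moment hα hL hw
  exact lintegral_sq_norm_batch_le (ψ := fun z : E d × E p => h w z.1 z.2) hM
    (hh.measurable.comp measurable_prodMk_left) h1 h2

lemma lintegral_batch_sub_le (hh : IsUnbiasedOn μ α B L G υ h) (hα : 0 < α)
    (hL : Integrable (fun ξ => L ξ ^ 2) μ) (hM : 0 < M) {w : E d} (hw : w ∈ B) :
    ∫⁻ x : Fin M → E d × E p, ENNReal.ofReal (‖batch h w x - G w‖ ^ 2)
      ∂Measure.pi (fun _ => (unifBox d α).prod μ) ≤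
      ENNReal.ofReal ((υ * ∫ ξ, L ξ ^ 2 ∂μ) / M) := by
  have := isProbabilityMeasure_unifBox (d := d) hα
  obtain ⟨h1, h2⟩ := hh.second_moment hα hL hw
  have := lintegral_sq_norm_batch_sub_mean_le (ψ := fun z : E d × E p => h w z.1 z.2) hM
    (hh.measurable.comp measurable_prodMk_left) h1 h2
  rwa [hh.mean w hw] at this

end IsUnbiasedOn

namespace IsRun

variable {Ω : Type*} {mΩ : MeasurableSpace Ω} {P : Measure Ω} {d p : ℕ} {μ : Measure (E p)}
  {α : ℝ} {A : Set (E d)} {η : ℝ} {K M : ℕ}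
  {g : E d → E d → E p → E d} {w₁ : E d} {ℱ : Filtration ℕ mΩ} {u : ℕ → Fin M → Ω → E d}
  {ξ : ℕ → Fin M → Ω → E p} {R : Ω → ℕ} {w : ℕ → Ω → E d}

lemma ae_mem (hrun : IsRun P μ α A η K M g w₁ ℱ u ξ R w) (hw₁ : w₁ ∈ A) {k : ℕ}
    (hk : k ∈ Finset.Icc 1 (K + 1)) : ∀ᵐ ω ∂P, w k ω ∈ A := by
  rw [Finset.mem_Icc] at hk
  obtain ⟨j, rfl⟩ := Nat.exists_eq_add_of_le' hk.1
  rcases Nat.eq_zero_or_pos j with rfl | hj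
  · exact Eventually.of_forall fun ω => by rw [zero_add, hrun.start]; exact hw₁
  · filter_upwards [hrun.step j (Finset.mem_Icc.2 (by omega))] with ω hω using hω.1

lemma measurable_samples (hrun : IsRun P μ α A η K M g w₁ ℱ u ξ R w) {k : ℕ}
    (hk : k ∈ Finset.Icc 1 K) : Measurable[ℱ (k + 1)] fun ω i => (u k i ω, ξ k i ω) :=
  @measurable_pi_lambda _ _ _ (ℱ (k + 1)) _ _ fun i =>
    (hrun.measurable_u k hk i).prodMk (hrun.measurable_ξ k hk i)

lemma ae_mem_box [IsProbabilityMeasure μ] (hrun : IsRun P μ α A η K M g w₁ ℱ u ξ R w) {k : ℕ}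
    (hk : k ∈ Finset.Icc 1 K) : ∀ᵐ ω ∂P, ∀ i, u k i ω ∈ box d (ENNReal.ofReal (α / 2)) := by
  refine ae_all_iff.2 fun i => ?_
  have hm : Measurable fun ω => (u k i ω, ξ k i ω) :=
    ((hrun.measurable_u k hk i).prodMk (hrun.measurable_ξ k hk i)).mono (ℱ.le _) le_rfl
  refine ae_of_ae_map (p := fun z : E d × E p => z.1 ∈ box d (ENNReal.ofReal (α / 2)))
    hm.aemeasurable ?_
  rw [hrun.law_sample k hk i]
  exact Measure.quasiMeasurePreserving_fst.ae (SPA.ae_mem_box d α)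

lemma lintegral_le [IsProbabilityMeasure P] [IsProbabilityMeasure μ]
    (hrun : IsRun P μ α A η K M g w₁ ℱ u ξ R w) (hw₁ : w₁ ∈ A) {k : ℕ}
    (hk : k ∈ Finset.Icc 1 K) {Φ : E d × (Fin M → E d × E p) → ℝ≥0∞} (hΦ : Measurable Φ)
    {c : ℝ≥0∞} (hc : ∀ x ∈ A, ∫⁻ z, Φ (x, z) ∂Measure.pi (fun _ => (unifBox d α).prod μ) ≤ c) :
    ∫⁻ ω, Φ (w k ω, fun i => (u k i ω, ξ k i ω)) ∂P ≤ c := by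
  have hk' : k ∈ Finset.Icc 1 (K + 1) := by
    rw [Finset.mem_Icc] at hk ⊢; omega
  have hX := hrun.measurable_samples hk
  have hXi : ∀ i, Measurable fun ω => (u k i ω, ξ k i ω) := fun i =>
    ((hrun.measurable_u k hk i).prodMk (hrun.measurable_ξ k hk i)).mono (ℱ.le _) le_rfl
  have hwm := hrun.measurable_w k hk'
  have hind : IndepFun (w k) (fun ω i => (u k i ω, ξ k i ω)) P :=
    indep_of_indep_of_le_left (hrun.indep_past k hk).symm hwm.comap_le
  refine lintegral_le_of_indepFun (hwm.mono (ℱ.le _) le_rfl) (hX.mono (ℱ.le _) le_rfl) hind ?_ hΦ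
    ((hrun.ae_mem hw₁ hk').mono fun ω hω => hc _ hω)
  rw [(hrun.indep_batch k hk).map_fun_eq_pi_map fun i => (hXi i).aemeasurable]
  simp only [hrun.law_sample k hk]

end IsRun

/-- Stationarity bound for a run of the projected method driven by an unbiased estimator of the
gradient of a function `φ` with Lipschitz gradient `G`. -/
lemma IsRun.lintegral_stationarity_le {Ω : Type*} {mΩ : MeasurableSpace Ω} {P : Measure Ω}
    [IsProbabilityMeasure P] {d p : ℕ} {μ : Measure (E p)} [IsProbabilityMeasure μ] {α : ℝ}
    {A : Set (E d)} {η : ℝ} {K M : ℕ} {g h : E d → E d → E p → E d} {w₁ : E d}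
    {ℱ : Filtration ℕ mΩ} {u : ℕ → Fin M → Ω → E d} {ξ : ℕ → Fin M → Ω → E p} {R : Ω → ℕ}
    {w : ℕ → Ω → E d} (hrun : IsRun P μ α A η K M g w₁ ℱ u ξ R w) (hw₁ : w₁ ∈ A) (hα : 0 < α)
    (hK : 0 < K) (hM : 0 < M) {φ : E d → ℝ} {G : E d → E d} {L : E p → ℝ} {Λ ρ τ υ Δ : ℝ}
    (hυ : 0 ≤ υ) (hΛ : 0 < Λ) (hφ : ∀ z, HasGradientAt φ (G z) z)
    (hG : ∀ z z', ‖G z - G z'‖ ≤ Λ * ‖z - z'‖) (hρ : 0 < ρ) (hτ : 0 ≤ τ) (hρτ : 1 < ρ + τ)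
    (hη : η = 2 / (3 * ρ * Λ)) (hL : Integrable (fun ξ => L ξ ^ 2) μ)
    (hh : IsUnbiasedOn μ α A L G υ h)
    (hgh : ∀ w ∈ A, ∀ u ∈ box d (ENNReal.ofReal (α / 2)), ∀ ξ, h w u ξ = g w u ξ)
    (hΔ0 : 0 ≤ Δ) (hΔ : ∀ x ∈ A, φ w₁ - φ x ≤ Δ) {Y : E d → ℝ≥0∞}
    (hY : ∀ x y z, y ∈ proj A (x - η • z) →
      Y y ≤ ENNReal.ofReal (‖G y - z - η⁻¹ • (y - x)‖ ^ 2)) :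
    ∫⁻ ω, Y (w (R ω) ω) ∂P ≤ ENNReal.ofReal
      (C₁ ρ τ * (Λ * Δ / K) + C₂ ρ τ M * (υ * (∫ ξ, L ξ ^ 2 ∂μ) / M)) := by
  have hMr : (0 : ℝ) < M := by exact_mod_cast hM
  have hKr : (0 : ℝ) < K := by exact_mod_cast hK
  have hs : 0 < τ + ρ - 1 := by linarith
  set Q := ∫ ξ, L ξ ^ 2 ∂μ with hQ
  have hQ0 : 0 ≤ Q := integral_nonneg fun _ => sq_nonneg _
  have hGc : Continuous G := by
    refine (LipschitzWith.of_dist_le_mul (K := Λ.toNNReal) fun x y => ?_).continuous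
    rw [Real.coe_toNNReal _ hΛ.le, dist_eq_norm, dist_eq_norm]
    exact hG x y
  set X : ℕ → Ω → Fin M → E d × E p := fun k ω i => (u k i ω, ξ k i ω) with hXdef
  set D : ℕ → Ω → E d := fun k ω => batch h (w k ω) (X k ω) with hD
  set Z : ℕ → Ω → E d := fun k ω =>
    G (w (k + 1) ω) - D k ω - η⁻¹ • (w (k + 1) ω - w k ω) with hZ
  have hIcc : ∀ k < K, k + 1 ∈ Finset.Icc 1 K := fun k hk => Finset.mem_Icc.2 (by omega)
  have hIcc' : ∀ k ≤ K, k + 1 ∈ Finset.Icc 1 (K + 1) := fun k hk => Finset.mem_Icc.2 (by omega)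
  -- All residuals, including the one that involves the last iterate, are measurable for `ℱ (K +
  -- 1)`, which is independent of `R`.
  have hwm : ∀ k ≤ K, Measurable[ℱ (K + 1)] (w (k + 1)) := fun k hk =>
    (hrun.measurable_w _ (hIcc' k hk)).mono (ℱ.mono (by omega)) le_rfl
  have hDm : ∀ k < K, Measurable[ℱ (K + 1)] (D (k + 1)) := fun k hk => by
    have h1 : Measurable[ℱ (K + 1)] (X (k + 1)) :=
      (hrun.measurable_samples (hIcc k hk)).mono (ℱ.mono (by omega)) le_rfl
    exact (measurable_batch hh.measurable).comp ((hwm k hk.le).prodMk h1)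
  have hZm : ∀ k < K, Measurable[ℱ (K + 1)] (Z (k + 1)) := fun k hk =>
    ((hGc.measurable.comp (hwm (k + 1) hk)).sub (hDm k hk)).sub
      (((hwm (k + 1) hk).sub (hwm k hk.le)).const_smul η⁻¹)
  have hsq : Measurable fun x : E d => ENNReal.ofReal (‖x‖ ^ 2) := by fun_prop
  have hstep : ∀ k < K, ∀ᵐ ω ∂P,
      w (k + 2) ω ∈ proj A (w (k + 1) ω - η • D (k + 1) ω) ∧ w (k + 1) ω ∈ A := fun k hk => by
    filter_upwards [hrun.step _ (hIcc k hk), hrun.ae_mem hw₁ (hIcc' k hk.le),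
      hrun.ae_mem_box (hIcc k hk)] with ω h1 h2 h3
    refine ⟨?_, h2⟩
    have : η • D (k + 1) ω = (η / M) • ∑ i, g (w (k + 1) ω) (u (k + 1) i ω) (ξ (k + 1) i ω) := by
      simp only [hD, batch, smul_smul, div_eq_mul_inv]
      congr 1
      exact Finset.sum_congr rfl fun i _ => hgh _ h2 _ (h3 i) _
    rwa [this]
  have hfirst := lintegral_uniform_index_le (P := P) hK hrun.measurable_R hrun.uniform_R
    (ℱ.le (K + 1)) hrun.indep_R (H := fun k ω => ENNReal.ofReal (‖Z (k + 1) ω‖ ^ 2))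
    (Y := fun k ω => Y (w k ω)) (fun k hk => hsq.comp (hZm k hk)) fun k hk => by
      filter_upwards [hstep k hk] with ω hω using hY _ _ _ hω.1
  set b := 2 * (1 + 3 * ρ) / (τ + ρ - 1) + 3 with hb
  set c := 2 * (1 + 3 * ρ) / (τ + ρ - 1) * (4 / 3 * (τ / ρ ^ 2)) with hc
  have hb0 : 0 ≤ b := by positivity
  have hc0 : 0 ≤ c := by positivity
  have hC₁ : 0 ≤ C₁ ρ τ := by rw [C₁]; positivity
  have hall : ∀ᵐ ω ∂P, ∀ k ∈ Finset.range K,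
      w (k + 2) ω ∈ proj A (w (k + 1) ω - η • D (k + 1) ω) ∧ w (k + 1) ω ∈ A :=
    (Finset.eventually_all _).2 fun k hk => hstep k (Finset.mem_range.1 hk)
  -- The sum telescopes pathwise, before integration: single decreases of `φ` may be negative, while
  -- only nonnegative quantities remain afterwards.
  have hsum : ∀ᵐ ω ∂P, ∑ k ∈ Finset.range K, ENNReal.ofReal (‖Z (k + 1) ω‖ ^ 2) ≤
      ENNReal.ofReal (C₁ ρ τ * Λ * Δ) + ∑ k ∈ Finset.range K,
        (ENNReal.ofReal b * ENNReal.ofReal (‖D (k + 1) ω - G (w (k + 1) ω)‖ ^ 2) +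
          ENNReal.ofReal c * ENNReal.ofReal (‖D (k + 1) ω‖ ^ 2)) := by
    filter_upwards [hall, hrun.ae_mem hw₁ (hIcc' K le_rfl)] with ω hω hlast
    simp only [← ENNReal.ofReal_mul hb0, ← ENNReal.ofReal_mul hc0]
    have hr : ∀ k, ENNReal.ofReal (b * ‖D (k + 1) ω - G (w (k + 1) ω)‖ ^ 2) +
        ENNReal.ofReal (c * ‖D (k + 1) ω‖ ^ 2) = ENNReal.ofReal
          (b * ‖D (k + 1) ω - G (w (k + 1) ω)‖ ^ 2 + c * ‖D (k + 1) ω‖ ^ 2) := fun k =>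
      (ENNReal.ofReal_add (by positivity) (by positivity)).symm
    simp only [hr]
    rw [← ENNReal.ofReal_sum_of_nonneg fun k _ => by positivity,
      ← ENNReal.ofReal_sum_of_nonneg fun k _ => by positivity,
      ← ENNReal.ofReal_add (by positivity) (Finset.sum_nonneg fun k _ => by positivity)]
    refine ENNReal.ofReal_le_ofReal ?_
    refine (Finset.sum_le_sum fun k hk => sq_norm_stationarity_le (τ := τ) (x := w (k + 1) ω)
      (y := w (k + 2) ω) (g := D (k + 1) ω) hΛ hφ hG hρ hτ hρτ hη
      ((hω k hk).1.2 _ (hω k hk).2)).trans ?_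
    rw [Finset.sum_add_distrib]
    refine add_le_add ?_ le_rfl
    rw [← Finset.mul_sum, Finset.sum_range_sub' (fun k => φ (w (k + 1) ω)), zero_add, hrun.start]
    exact mul_le_mul_of_nonneg_left (hΔ _ hlast) (by positivity)
  have hDm' : ∀ k < K, Measurable (D (k + 1)) := fun k hk => (hDm k hk).mono (ℱ.le _) le_rfl
  have hwm' : ∀ k ≤ K, Measurable (w (k + 1)) := fun k hk => (hwm k hk).mono (ℱ.le _) le_rfl
  have he : ∀ k < K, ∫⁻ ω, ENNReal.ofReal (‖D (k + 1) ω - G (w (k + 1) ω)‖ ^ 2) ∂P ≤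
      ENNReal.ofReal (υ * Q / M) := fun k hk =>
    hrun.lintegral_le hw₁ (hIcc k hk)
      (Φ := fun z => ENNReal.ofReal (‖batch h z.1 z.2 - G z.1‖ ^ 2))
      (hsq.comp ((measurable_batch hh.measurable).sub (hGc.measurable.comp measurable_fst)))
      fun x hx => hh.lintegral_batch_sub_le hα hL hM hx
  have hd : ∀ k < K, ∫⁻ ω, ENNReal.ofReal (‖D (k + 1) ω‖ ^ 2) ∂P ≤ ENNReal.ofReal (υ * Q) :=
    fun k hk => hrun.lintegral_le hw₁ (hIcc k hk)
      (Φ := fun z => ENNReal.ofReal (‖batch h z.1 z.2‖ ^ 2))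
      (hsq.comp (measurable_batch hh.measurable))
      fun x hx => hh.lintegral_batch_le hα hL hM hx
  have hm1 : ∀ k < K, Measurable fun ω => ENNReal.ofReal b *
      ENNReal.ofReal (‖D (k + 1) ω - G (w (k + 1) ω)‖ ^ 2) := fun k hk =>
    (hsq.comp ((hDm' k hk).sub (hGc.measurable.comp (hwm' k hk.le)))).const_mul _
  have hm2 : ∀ k < K, Measurable fun ω => ENNReal.ofReal c *
      ENNReal.ofReal (‖D (k + 1) ω‖ ^ 2) := fun k hk => (hsq.comp (hDm' k hk)).const_mul _
  have htotal : ∑ k ∈ Finset.range K, ∫⁻ ω, ENNReal.ofReal (‖Z (k + 1) ω‖ ^ 2) ∂P ≤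
      ENNReal.ofReal (C₁ ρ τ * Λ * Δ + K * (b * (υ * Q / M) + c * (υ * Q))) := by
    have hZm' : ∀ k ∈ Finset.range K, Measurable fun ω => ENNReal.ofReal (‖Z (k + 1) ω‖ ^ 2) :=
      fun k hk => (hsq.comp (hZm k (Finset.mem_range.1 hk))).mono (ℱ.le _) le_rfl
    rw [← lintegral_finsetSum _ hZm']
    have hm12 : ∀ k ∈ Finset.range K, Measurable fun ω =>
        ENNReal.ofReal b * ENNReal.ofReal (‖D (k + 1) ω - G (w (k + 1) ω)‖ ^ 2) +
          ENNReal.ofReal c * ENNReal.ofReal (‖D (k + 1) ω‖ ^ 2) := fun k hk =>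
      (hm1 k (Finset.mem_range.1 hk)).add (hm2 k (Finset.mem_range.1 hk))
    refine (lintegral_mono_ae hsum).trans ?_
    rw [lintegral_add_left measurable_const, lintegral_const, measure_univ, mul_one,
      lintegral_finsetSum _ hm12,
      ENNReal.ofReal_add (p := C₁ ρ τ * Λ * Δ) (by positivity) (by positivity)]
    refine add_le_add le_rfl ?_
    calc _ ≤ ∑ _k ∈ Finset.range K, ENNReal.ofReal (b * (υ * Q / M) + c * (υ * Q)) := by
          refine Finset.sum_le_sum fun k hk => ?_
          have hk' := Finset.mem_range.1 hk
          rw [lintegral_add_left (hm1 k hk'), lintegral_const_mul' _ _ ENNReal.ofReal_ne_top,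
            lintegral_const_mul' _ _ ENNReal.ofReal_ne_top,
            ENNReal.ofReal_add (p := b * (υ * Q / M)) (by positivity) (by positivity),
            ENNReal.ofReal_mul hb0,
            ENNReal.ofReal_mul hc0]
          gcongr
          · exact he k hk'
          · exact hd k hk'
      _ = _ := by
          rw [Finset.sum_const, Finset.card_range, nsmul_eq_mul, ENNReal.ofReal_mul hKr.le,
            ENNReal.ofReal_natCast]
  refine hfirst.trans ((mul_le_mul_right htotal _).trans_eq ?_)
  rw [← ENNReal.ofReal_natCast, ← ENNReal.ofReal_inv_of_pos hKr,
    ← ENNReal.ofReal_mul (by positivity)]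
  congr 1
  -- Here `C₂ = b + M c`: the squared-norm term lacks the gain `1 / M`, which explains the factor `M
  -- τ` in `C₂`.
  rw [C₂, hb, hc]
  field_simp
  ring

lemma smooth_congr {d : ℕ} {α : ℝ} {β : ℝ≥0∞} {f f' : E d → ℝ}
    (hff' : ∀ x ∈ box d (β + ENNReal.ofReal (α / 2)), f x = f' x) {w : E d} (hw : w ∈ box d β) :
    smooth α f w = smooth α f' w :=
  integral_congr_ae ((ae_mem_box d α).mono fun _ hu => hff' _ (add_mem_box hw hu))

end SPA

theorem corollary1 {Ω : Type*} {mΩ : MeasurableSpace Ω} (P : Measure Ω) [IsProbabilityMeasure P]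
    {d p : ℕ} (μ : Measure (SPA.E p)) [IsProbabilityMeasure μ]
    -- the loss, the smoothing parameter, and the radii of the boxes
    (F : SPA.E d → SPA.E p → ℝ) (L : SPA.E p → ℝ) (α : ℝ) (β κ : ℝ≥0∞) (αhat : ℝ)
    (hα : 0 < α) (hβ : 0 < β) (hαhat : αhat = √(d : ℝ) * (α / 2))
    -- `β = ∞` is allowed when the loss is Lipschitz on the whole space
    (hκ : β + ENNReal.ofReal αhat < κ ∨ (β = ⊤ ∧ κ = ⊤))
    (hF : SPA.LossAssumptions μ κ F L)
    (L₀ Q : ℝ) (hL₀ : L₀ = ∫ ξ, L ξ ∂μ) (hQ : Q = ∫ ξ, L ξ ^ 2 ∂μ)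
    -- the constraint set
    (S : Set (SPA.E d)) (hS : IsClosed S)
    -- the parameters
    (ρ τ η : ℝ) (hρ : 0 < ρ) (hτ : 0 ≤ τ) (hρτ : 1 < ρ + τ)
    (hη : 0 < η) (hη_eq : η = α / (3 * ρ * √(d : ℝ) * L₀))
    (K M : ℕ) (hK : 0 < K) (hM : 0 < M)
    (w₁ : SPA.E d) (hw₁ : w₁ ∈ S ∩ SPA.box d β)
    -- `wmin` minimizes the smoothed loss over the feasible set
    (wmin : SPA.E d) (hwmin : wmin ∈ S ∩ SPA.box d β)
    (hmin : IsMinOn (SPA.smooth α (SPA.loss μ F)) (S ∩ SPA.box d β) wmin)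
    (Δ : ℝ) (hΔ : SPA.smooth α (SPA.loss μ F) w₁ - SPA.smooth α (SPA.loss μ F) wmin ≤ Δ)
    -- the run of the algorithm, in either of its two settings
    (g : SPA.E d → SPA.E d → SPA.E p → SPA.E d) (υ : ℝ) (hg : SPA.IsEstimator μ α β F g υ)
    (ℱ : Filtration ℕ mΩ) (u : ℕ → Fin M → Ω → SPA.E d) (ξ : ℕ → Fin M → Ω → SPA.E p)
    (R : Ω → ℕ) (w : ℕ → Ω → SPA.E d)
    (hrun : SPA.IsRun P μ α (S ∩ SPA.box d β) η K M g w₁ ℱ u ξ R w) :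
    ∫⁻ ω, Metric.infEDist (0 : SPA.E d)
        (SPA.clarkeEps αhat (SPA.loss μ F) (w (R ω) ω) +
          SPA.normalCone (S ∩ SPA.box d β) (w (R ω) ω)) ^ 2 ∂P ≤
      ENNReal.ofReal
        (SPA.C₁ ρ τ * (2 * α⁻¹ * √(d : ℝ) * L₀ * Δ / K) + SPA.C₂ ρ τ M * (υ * Q / M)) := by
  -- Division by zero would give `η = 0`, so `0 < η` encodes `d ≥ 1` and `L₀ ≠ 0`.
  have hdsq : √(d : ℝ) * L₀ ≠ 0 := by
    rintro h
    rw [hη_eq, mul_assoc (3 * ρ), h] at hη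
    simp at hη
  have hd : d ≠ 0 := by
    rintro rfl
    simp at hdsq
  have hκ0 : 0 < κ := by
    rcases hκ with h | h
    · exact bot_le.trans_lt h
    · simp [h.2]
  have hahat : α / 2 ≤ αhat := hαhat ▸ SPA.half_le_sqrt_mul hd hα
  have hκ1 : β + ENNReal.ofReal αhat < κ ∨ κ = ⊤ := hκ.imp_right fun h => h.2
  have hκ2 : β + ENNReal.ofReal (α / 2) < κ ∨ κ = ⊤ := hκ1.imp_left
    (add_le_add_right (ENNReal.ofReal_le_ofReal hahat) β).trans_lt
  obtain ⟨c, hc1, hcκ, hc⟩ := SPA.exists_retraction d κ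
  have hG := hF.globalLoss hd hκ0 hc1 hcκ
  obtain ⟨h, hgh, hh⟩ := hg.exists_isUnbiasedOn hα hκ2 hc hG
  set f' := SPA.loss μ fun w => F (c w) with hf'
  have hff' : ∀ x ∈ SPA.box d κ, SPA.loss μ F x = f' x := fun x hx => by
    rw [hf', SPA.loss, SPA.loss, hc x hx]
  have hL₀0 : 0 ≤ L₀ := hL₀ ▸ integral_nonneg_of_ae hG.lip_nonneg
  have hL₀pos : 0 < L₀ := hL₀0.lt_of_ne' (right_ne_zero_of_mul hdsq)
  have hlip : LipschitzWith L₀.toNNReal f' := hL₀ ▸ hG.lipschitzWith_loss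
  have hsd : 0 < √(d : ℝ) := Real.sqrt_pos.2 (by exact_mod_cast Nat.pos_of_ne_zero hd)
  have hbox2 : SPA.box d (β + ENNReal.ofReal (α / 2)) ⊆ SPA.box d κ := SPA.box_mono d (by
    rcases hκ2 with h | h
    · exact h.le
    · simp [h])
  have hsm : ∀ x ∈ SPA.box d β, SPA.smooth α (SPA.loss μ F) x = SPA.smooth α f' x := fun x hx =>
    SPA.smooth_congr (fun y hy => hff' y (hbox2 hy)) hx
  have hυ : 0 ≤ υ := by
    cases hg
    · positivity
    · exact zero_le_one
  have hmin' : ∀ x ∈ S ∩ SPA.box d β, SPA.smooth α f' wmin ≤ SPA.smooth α f' x := fun x hx => by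
    rw [← hsm x hx.2, ← hsm wmin hwmin.2]
    exact hmin hx
  rw [hsm _ hw₁.2, hsm _ hwmin.2] at hΔ
  rw [hQ]
  refine hrun.lintegral_stationarity_le (φ := SPA.smooth α f') (G := SPA.smoothGrad α f')
    (h := h) (Λ := 2 * α⁻¹ * √(d : ℝ) * L₀)
    (Y := fun x => Metric.infEDist (0 : SPA.E d) (SPA.clarkeEps αhat (SPA.loss μ F) x +
      SPA.normalCone (S ∩ SPA.box d β) x) ^ 2)
    hw₁ hα hK hM hυ (by positivity) (SPA.hasGradientAt_smooth hα hlip) (fun z z' => ?_) hρ hτ hρτ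
    ?_ hF.sq_integrable_lip ⟨hh.measurable, fun w hw => hh.mean w hw.2,
      fun w hw => hh.sq_norm_le w hw.2⟩ (fun w hw => hgh w hw.2)
    ((sub_nonneg.2 (hmin' _ hw₁)).trans hΔ) (fun x hx => ?_) fun x y z hy => ?_
  · simpa [Real.coe_toNNReal _ hL₀0] using SPA.norm_smoothGrad_sub_le hα hlip z z'
  · rw [hη_eq]; field_simp
  · linarith [hmin' x hx]
  -- Clarke subdifferentials are local, and the ball of radius `αhat` around `y` lies in the
  -- interior of the `κ`-box, where both losses agree.
  · have hcl : SPA.clarkeEps αhat (SPA.loss μ F) y = SPA.clarkeEps αhat f' y := by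
      refine SPA.clarkeEps_congr fun x hx => ?_
      have hxb : x ∈ SPA.box d (β + ENNReal.ofReal αhat) := by
        have := SPA.add_mem_box hy.1.2 (SPA.mem_box_of_norm_le (mem_closedBall_iff_norm.1 hx))
        rwa [add_sub_cancel] at this
      filter_upwards [SPA.box_mem_nhds hκ1 hxb] with x' hx' using hff' x' hx'
    have hmem := SPA.smoothGrad_mem_closure_clarkeEps hα hlip y
    rw [← hαhat, ← hcl] at hmem
    have hnc := SPA.frechetNormalCone_subset_normalCone _ _
      (SPA.smul_sub_mem_frechetNormalCone hy (inv_nonneg.2 hη.le))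
    have hle := SPA.infEDist_add_le hmem hnc
    -- Smoothed gradient plus the projection normal is exactly the residual of the energy estimate.
    have heq : SPA.smoothGrad α f' y + η⁻¹ • (x - η • z - y) =
        SPA.smoothGrad α f' y - z - η⁻¹ • (y - x) := by
      rw [smul_sub, smul_sub, smul_sub, inv_smul_smul₀ hη.ne']
      abel
    rw [heq] at hle
    refine (pow_le_pow_left₀ bot_le hle 2).trans_eq ?_
    rw [← ofReal_norm, ENNReal.ofReal_pow (norm_nonneg _)]
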